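/- Let $k$ be an algebraically closed field of characteristic $\neq 2$, $R=k[x,y,z]$, and let $J\subset R$ be the defining ideal of four points of $\mathbb{P}^2_k$ in general linear position (no three on a line). Let $I=(J,I_2(\Theta))$ be the Jacobian ideal of $J$, where $\Theta$ is the Jacobian matrix of a finite set of generators of $J$ and $I_t(M)$ denotes the ideal generated by the $t$-minors of a matrix $M$. There is a $5\times 5$ skew-symmetric matrix $\phi$ of linear forms of $R$ whose five (signed) $4\times 4$ Pfaffians $f_1,\dots,f_5$ generate $I$. For every such $\phi$, let $\mathbf T=(T_1,\dots,T_5)$ be new variables and let $\psi$ be the Jacobian dual matrix of $\phi$, that is, the $5\times 3$ Jacobian matrix with respect to $x,y,z$ of the entries of $\mathbf T\cdot\phi$. Then $T_i\mapsto f_it$ induces an isomorphism of $R$-algebras $$R[\mathbf T]/\bigl(I_1(\mathbf T\cdot\phi),\,I_3(\psi)\bigr)\;\simeq\;\mathcal R_R(I)=\bigoplus_{s\ge 0}I^st^s .$$ Thus $I$ is of fiber type: the kernel of $R[\mathbf T]\to\mathcal R_R(I)$, $T_i\mapsto f_it$, is generated by its elements that are linear in $\mathbf T$ and its elements in $k[\mathbf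 T]$. Moreover $\mathcal R_R(I)$ has depth $1$ (with respect to its maximal homogeneous ideal $(x,y,z,It)$). -/

import Mathlib

open MvPolynomial
open scoped LinearAlgebra.Projectivization

noncomputable section

namespace JacobianRees

variable {k : Type*} [Field k]

/-- Points of `ℙⁿ` (at least `n + 1` of them) are in general linear position if no `n + 1` of them
lie in a hyperplane, i.e. if any `n + 1` of them are independent. -/
def InGeneralLinearPosition {n s : ℕ} (p : Fin s → ℙ k (Fin (n + 1) → k)) : Prop :=
  ∀ σ : Fin (n + 1) ↪ Fin s, Projectivization.Independent (fun i => p (σ i))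

/-- The homogeneous ideal of a point of projective space, generated by the forms that vanish at
the point. -/
def pointIdeal {n : ℕ} (p : ℙ k (Fin (n + 1) → k)) : Ideal (MvPolynomial (Fin (n + 1)) k) :=
  Ideal.span {f | ∃ d : ℕ, f.IsHomogeneous d ∧ eval p.rep f = 0}

/-- The defining ideal of a finite set of points: the intersection of the ideals of the points. -/
def pointsIdeal {n s : ℕ} (p : Fin s → ℙ k (Fin (n + 1) → k)) :
    Ideal (MvPolynomial (Fin (n + 1)) k) :=
  ⨅ i, pointIdeal (p i)

/-- The ideal `I_t(M)` generated by the `t × t` minors of `M`. (Repeated rows or columns only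
contribute the minor `0`.) -/
def minorsIdeal {A : Type*} [CommRing A] {a b : ℕ} (t : ℕ) (M : Matrix (Fin a) (Fin b) A) :
    Ideal A :=
  Ideal.span {d | ∃ (r : Fin t → Fin a) (c : Fin t → Fin b), d = (M.submatrix r c).det}

/-- The Jacobian matrix of a finite sequence of polynomials. -/
def jacobianMatrix {n m : ℕ} (g : Fin m → MvPolynomial (Fin n) k) :
    Matrix (Fin m) (Fin n) (MvPolynomial (Fin n) k) :=
  Matrix.of fun i j => pderiv j (g i)

/-- The Jacobian ideal `(J, I_r(Θ))` of `J = (g)`, with `Θ` the Jacobian matrix of `g`;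
here `r` is to be the height of `J`. -/
def jacobianIdeal {n m : ℕ} (r : ℕ) (g : Fin m → MvPolynomial (Fin n) k) :
    Ideal (MvPolynomial (Fin n) k) :=
  Ideal.span (Set.range g) ⊔ minorsIdeal r (jacobianMatrix g)

/-- The Pfaffian of a `4 × 4` skew-symmetric matrix. -/
def pfaffian4 {A : Type*} [CommRing A] (M : Matrix (Fin 4) (Fin 4) A) : A :=
  M 0 1 * M 2 3 - M 0 2 * M 1 3 + M 0 3 * M 1 2

/-- The five signed (submaximal) Pfaffians of a `5 × 5` skew-symmetric matrix: the `i`-th one is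
`(-1)ⁱ` times the Pfaffian of the matrix with row and column `i` deleted. -/
def pfaffians {A : Type*} [CommRing A] (φ : Matrix (Fin 5) (Fin 5) A) (i : Fin 5) : A :=
  (-1) ^ (i : ℕ) * pfaffian4 (φ.submatrix i.succAbove i.succAbove)

/-- `φ` is a `5 × 5` skew-symmetric matrix of linear forms whose Pfaffians generate `I`. -/
structure IsPfaffianMatrix {n : ℕ} (φ : Matrix (Fin 5) (Fin 5) (MvPolynomial (Fin n) k))
    (I : Ideal (MvPolynomial (Fin n) k)) : Prop where
  skew : φ.transpose = -φ
  linear : ∀ i j, (φ i j).IsHomogeneous 1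
  span_eq : Ideal.span (Set.range (pfaffians φ)) = I

/-- The entries of the row vector `T · φ`, in `R[T]`. -/
def TMul {A : Type*} [CommRing A] {a b : ℕ} (φ : Matrix (Fin a) (Fin b) A) (j : Fin b) :
    MvPolynomial (Fin a) A :=
  ∑ i, X i * C (φ i j)

/-- The partial derivative `∂/∂x_l` on `R[T] = k[x][T]`, i.e. `∂/∂x_l` of the coefficients. -/
def xDeriv {n a : ℕ} (l : Fin n) (P : MvPolynomial (Fin a) (MvPolynomial (Fin n) k)) :
    MvPolynomial (Fin a) (MvPolynomial (Fin n) k) :=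
  ∑ e ∈ P.support, monomial e (pderiv l (P.coeff e))

/-- The Jacobian dual matrix of `φ`: the Jacobian matrix of the entries of `T · φ` with respect to
the variables `x`. -/
def jacobianDual {n a b : ℕ} (φ : Matrix (Fin a) (Fin b) (MvPolynomial (Fin n) k)) :
    Matrix (Fin b) (Fin n) (MvPolynomial (Fin a) (MvPolynomial (Fin n) k)) :=
  Matrix.of fun j l => xDeriv l (TMul φ j)

/-- The ideal `(I_1(T · φ), I_3(ψ))` of `R[T]`, with `ψ` the Jacobian dual matrix of `φ`. -/
def dualIdeal {n a b : ℕ} (φ : Matrix (Fin a) (Fin b) (MvPolynomial (Fin n) k)) :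
    Ideal (MvPolynomial (Fin a) (MvPolynomial (Fin n) k)) :=
  Ideal.span (Set.range (TMul φ)) ⊔ minorsIdeal 3 (jacobianDual φ)

/-- The presentation ideal of the Rees algebra of `(f)` with respect to `f`: the kernel of
`R[T] → R[t]`, `T_i ↦ f_i t`. -/
def reesIdeal {A : Type*} [CommRing A] {m : ℕ} (f : Fin m → A) : Ideal (MvPolynomial (Fin m) A) :=
  RingHom.ker (aeval (fun i => Polynomial.monomial 1 (f i)) :
    MvPolynomial (Fin m) A →ₐ[A] Polynomial A)

/-- The presentation ideal of the Rees algebra is generated by its elements that are linear in `T`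
(the relations of the symmetric algebra) and by its elements in `k[T]` (the relations of the
special fiber; `f` consists of forms of one degree). -/
def HasFiberTypeRelations {n m : ℕ} (f : Fin m → MvPolynomial (Fin n) k) : Prop :=
  reesIdeal f =
    Ideal.span {P | P ∈ reesIdeal f ∧ P.IsHomogeneous 1} ⊔
    Ideal.span {P | P ∈ reesIdeal f ∧ ∃ Q : MvPolynomial (Fin m) k, P = map C Q}

/-- An ideal generated by forms of one degree is of fiber type if its Rees algebra, presented by
such generators, has only fiber type relations. -/
def IsFiberType {n : ℕ} (I : Ideal (MvPolynomial (Fin n) k)) : Prop :=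
  ∃ (m d : ℕ) (f : Fin m → MvPolynomial (Fin n) k),
    (∀ i, (f i).IsHomogeneous d) ∧ Ideal.span (Set.range f) = I ∧ HasFiberTypeRelations f

/-- The maximal homogeneous ideal `(x, It)` of the Rees algebra of `I ⊆ k[x]`: the elements whose
component of degree `0` in `t` has no constant term. -/
def reesMaximalIdeal {n : ℕ} (I : Ideal (MvPolynomial (Fin n) k)) : Ideal (reesAlgebra I) :=
  RingHom.ker (((constantCoeff : MvPolynomial (Fin n) k →+* k).comp
    (Polynomial.constantCoeff : Polynomial (MvPolynomial (Fin n) k) →+* _)).comp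
      (reesAlgebra I).val.toRingHom)

/-- The depth (grade) of a ring `A` along an ideal `𝔞`: the supremum of the lengths of the
`A`-regular sequences in `𝔞`. -/
def depthAlong {A : Type*} [CommRing A] (𝔞 : Ideal A) : ℕ∞ :=
  ⨆ (rs : List A) (_ : RingTheory.Sequence.IsRegular A rs) (_ : ∀ r ∈ rs, r ∈ 𝔞),
    (rs.length : ℕ∞)

end JacobianRees

end

open JacobianRees

/-
In suitable coordinates the four points are `(±1, ±1, 1)`, so that `J = (x² - z², y² - z²)` and
`I = (xy, xz, yz, x² - z², y² - z²)`, which together with `z²` generates the square of the ideal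
`𝔪 = (x, y, z)`. Moreover `𝔪 z² ⊆ I` and `I z² ⊆ I²`.

Suppose that elements `x`, `y`, `z`, `T` of an algebra satisfy the relations `T · φ = 0` and
`I₃(ψ) = 0`. They tell how an element `W` that stands for `z² t` has to multiply with all the
others, and adjoining it gives an algebra in which the relations of the Rees algebra of `𝔪²` hold.
That algebra is toric with an explicit presentation, hence the given elements satisfy every relation
of the Rees algebra of `I`. Another skew-symmetric matrix for `I` differs from a fixed one by linear
changes of `T` and of the relations: its columns are independent over `k`, for otherwise all its
Pfaffians would be proportional.

The depth is `1` because `z² t` lies outside the Rees algebra, while its products with the maximal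
homogeneous ideal lie inside.
-/

noncomputable section

namespace JacobianRees

section Veronese

variable {ι B : Type*} [CommRing B]

/-- The relations between the generators `x i` and `x i * x j * t` of the Rees algebra of the square
of the ideal of the variables, for elements `ξ i` and `S i j` in their place. -/
structure VeroneseRelations (ξ : ι → B) (S : ι → ι → B) : Prop where
  symm : ∀ i j, S i j = S j i
  linear : ∀ i j l, ξ i * S j l = ξ j * S i l
  quadratic : ∀ i j l m, S i j * S l m = S i l * S j m

/-- The product of `S i j` over the first `s` pairs of consecutive entries of a list and of `ξ i`
over the remaining entries; it is `0` if there are fewer than `s` pairs. -/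
def pairedProd (ξ : ι → B) (S : ι → ι → B) : ℕ → List ι → B
  | 0, l => (l.map ξ).prod
  | s + 1, i :: j :: l => S i j * pairedProd ξ S s l
  | _ + 1, _ => 0

variable {ξ : ι → B} {S : ι → ι → B}

lemma pairedProd_append_singleton (i : ι) : ∀ (s : ℕ) (l : List ι), 2 * s ≤ l.length →
    pairedProd ξ S s (l ++ [i]) = ξ i * pairedProd ξ S s l
  | 0, l, _ => by simp [pairedProd, mul_comm]
  | s + 1, [], h => by simp at h
  | s + 1, [a], h => by rw [List.length_singleton] at h; omega
  | s + 1, a :: b :: l, h => by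
      have hl : 2 * s ≤ l.length := by rw [List.length_cons, List.length_cons] at h; omega
      rw [List.cons_append, List.cons_append, pairedProd, pairedProd,
        pairedProd_append_singleton i s l hl, mul_left_comm]

/-- The element that stands for `x ^ α * t ^ s`: `α` is listed in some order, which does not matter
if `ξ` and `S` satisfy the Veronese relations. -/
def veroneseMonomial (ξ : ι → B) (S : ι → ι → B) (s : ℕ) (α : ι →₀ ℕ) : B :=
  pairedProd ξ S s (Finsupp.toMultiset α).toList

lemma two_mul_le_length_toList {s : ℕ} {α : ι →₀ ℕ} (hs : 2 * s ≤ α.degree) :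
    2 * s ≤ (Finsupp.toMultiset α).toList.length := by
  rwa [Multiset.length_toList, Finsupp.card_toMultiset]

variable {k : Type*} [CommRing k] [Algebra k B]

/-- The map `x_i ↦ x_i`, `S_ij ↦ x_i x_j t` from a polynomial ring onto the Rees algebra of the
square of the ideal of the variables. -/
def veroneseMap (ι k : Type*) [CommRing k] :
    MvPolynomial (ι ⊕ ι × ι) k →ₐ[k] Polynomial (MvPolynomial ι k) :=
  aeval (Sum.elim (fun i => Polynomial.C (X i)) fun ij => Polynomial.monomial 1 (X ij.1 * X ij.2))

/-- The `k`-linear map `x ^ α * t ^ s ↦ veroneseMonomial ξ S s α`. -/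
def veroneseSection (k : Type*) [CommRing k] [Algebra k B] (ξ : ι → B) (S : ι → ι → B) :
    Polynomial (MvPolynomial ι k) →ₗ[k] B :=
  Polynomial.lsum fun s => (basisMonomials ι k).constr k (veroneseMonomial ξ S s)

lemma veroneseSection_monomial (s : ℕ) (α : ι →₀ ℕ) (a : k) :
    veroneseSection k ξ S (Polynomial.monomial s (monomial α a)) =
      a • veroneseMonomial ξ S s α := by
  have h : (monomial α a : MvPolynomial ι k) = a • basisMonomials ι k α := by
    simp [smul_monomial]
  rw [veroneseSection, Polynomial.lsum_apply,
    Polynomial.sum_monomial_index _ _ (by simp), h, map_smul, Module.Basis.constr_basis]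

namespace VeroneseRelations

lemma pairedProd_swap (h : VeroneseRelations ξ S) (i j : ι) (r : List ι) : ∀ (s : ℕ) (p : List ι),
    pairedProd ξ S s (p ++ i :: j :: r) = pairedProd ξ S s (p ++ j :: i :: r)
  | 0, p => by
      simp only [pairedProd, List.map_append, List.map_cons, List.prod_append, List.prod_cons]
      ring
  | s + 1, [] => by simp [pairedProd, h.symm i j]
  | 1, [a] => by
      simp only [pairedProd, List.cons_append, List.nil_append, List.map_cons, List.prod_cons]
      linear_combination (r.map ξ).prod * (h.linear j i a - h.symm i a * ξ j + h.symm j a * ξ i)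
  | s + 2, [a] => by
      cases r with
      | nil => simp [pairedProd]
      | cons b r =>
        simp only [pairedProd, List.cons_append, List.nil_append]
        linear_combination pairedProd ξ S s r * h.quadratic a i j b
  | s + 1, a :: b :: p => by
      simp only [pairedProd, List.cons_append]
      rw [h.pairedProd_swap i j r s p]

lemma pairedProd_perm (h : VeroneseRelations ξ S) (s : ℕ) {l l' : List ι} (hl : l.Perm l') :
    pairedProd ξ S s l = pairedProd ξ S s l' := by
  suffices ∀ p : List ι, pairedProd ξ S s (p ++ l) = pairedProd ξ S s (p ++ l') by
    simpa using this []
  induction hl with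
  | nil => simp
  | cons x _ ih => intro p; simpa using ih (p ++ [x])
  | swap x y l => intro p; exact h.pairedProd_swap _ _ _ _ _
  | trans _ _ ih1 ih2 => intro p; rw [ih1, ih2]

lemma veroneseMonomial_add_single (h : VeroneseRelations ξ S) {s : ℕ} {α : ι →₀ ℕ}
    (hs : 2 * s ≤ α.degree) (i : ι) :
    veroneseMonomial ξ S s (α + Finsupp.single i 1) = ξ i * veroneseMonomial ξ S s α := by
  have hperm : (Finsupp.toMultiset (α + Finsupp.single i 1)).toList.Perm
      ((Finsupp.toMultiset α).toList ++ [i]) := by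
    rw [← Multiset.coe_eq_coe, ← Multiset.coe_add]
    simp
  rw [veroneseMonomial, h.pairedProd_perm s hperm,
    pairedProd_append_singleton i s _ (two_mul_le_length_toList hs), veroneseMonomial]

lemma veroneseMonomial_succ_add_single_add_single (h : VeroneseRelations ξ S) (s : ℕ)
    (α : ι →₀ ℕ) (i j : ι) :
    veroneseMonomial ξ S (s + 1) (α + (Finsupp.single i 1 + Finsupp.single j 1)) =
      S i j * veroneseMonomial ξ S s α := by
  have hperm : (Finsupp.toMultiset (α + (Finsupp.single i 1 + Finsupp.single j 1))).toList.Perm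
      (i :: j :: (Finsupp.toMultiset α).toList) := by
    rw [← Multiset.coe_eq_coe, ← Multiset.cons_coe, ← Multiset.cons_coe]
    simp only [Multiset.coe_toList, map_add, Finsupp.toMultiset_single, one_smul,
      ← Multiset.singleton_add]
    abel
  rw [veroneseMonomial, h.pairedProd_perm _ hperm, pairedProd, veroneseMonomial]

lemma exists_veroneseMonomial (h : VeroneseRelations ξ S) (u : ι ⊕ ι × ι →₀ ℕ) (a : k) :
    ∃ (α : ι →₀ ℕ) (s : ℕ) (b : k), 2 * s ≤ α.degree ∧
      veroneseMap ι k (monomial u a) = Polynomial.monomial s (monomial α b) ∧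
      aeval (Sum.elim ξ fun ij => S ij.1 ij.2) (monomial u a) = b • veroneseMonomial ξ S s α := by
  refine induction_on_monomial (motive := fun g => ∃ (α : ι →₀ ℕ) (s : ℕ) (b : k),
    2 * s ≤ α.degree ∧ veroneseMap ι k g = Polynomial.monomial s (monomial α b) ∧
      aeval (Sum.elim ξ fun ij => S ij.1 ij.2) g = b • veroneseMonomial ξ S s α) ?_ ?_ u a
  · refine fun b => ⟨0, 0, b, by simp, ?_, ?_⟩
    · exact algHom_C _ b
    · simp [veroneseMonomial, pairedProd, Algebra.algebraMap_eq_smul_one]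
  · rintro p (i | ⟨i, j⟩) ⟨α, s, b, hs, hp, hp'⟩
    · refine ⟨α + Finsupp.single i 1, s, b, ?_, ?_, ?_⟩
      · rw [map_add]; omega
      · rw [map_mul, hp, veroneseMap, aeval_X, Sum.elim_inl, Polynomial.monomial_mul_C, X,
          monomial_mul, mul_one]
      · rw [map_mul, hp', aeval_X, Sum.elim_inl, h.veroneseMonomial_add_single hs, smul_mul_assoc,
          mul_comm]
    · refine ⟨α + (Finsupp.single i 1 + Finsupp.single j 1), s + 1, b, ?_, ?_, ?_⟩
      · rw [map_add, map_add, Finsupp.degree_single, Finsupp.degree_single]; omega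
      · rw [map_mul, hp, veroneseMap, aeval_X, Sum.elim_inr, Polynomial.monomial_mul_monomial, X, X,
          monomial_mul, monomial_mul, mul_one, mul_one]
      · rw [map_mul, hp', aeval_X, Sum.elim_inr, h.veroneseMonomial_succ_add_single_add_single,
          smul_mul_assoc, mul_comm]

theorem aeval_eq_zero_of_veroneseMap_eq_zero (h : VeroneseRelations ξ S)
    {g : MvPolynomial (ι ⊕ ι × ι) k} (hg : veroneseMap ι k g = 0) :
    aeval (Sum.elim ξ fun ij => S ij.1 ij.2) g = 0 := by
  suffices veroneseSection k ξ S (veroneseMap ι k g) = aeval (Sum.elim ξ fun ij => S ij.1 ij.2) g by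
    rw [← this, hg, map_zero]
  clear hg
  induction g using MvPolynomial.induction_on' with
  | add p q hp hq => simp only [map_add, hp, hq]
  | monomial u a =>
    obtain ⟨α, s, b, -, hα, hα'⟩ := h.exists_veroneseMonomial u a
    rw [hα, hα', veroneseSection_monomial]

end VeroneseRelations

end Veronese

section Extension

open Matrix

universe u w

variable {ι : Type u} {k : Type w} {A : Type*} [CommRing k] [CommRing A] [Algebra k A]

/-- `T` acts on the polynomials `f` without constant term as `f ↦ f(v) * W` would, for a virtual
element `W` with `v i * W = p i`. -/
structure IsVirtualMul (v p : ι → A) (T : MvPolynomial ι k →ₗ[k] A) : Prop where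
  apply_X : ∀ i, T (X i) = p i
  apply_mul : ∀ f g, T (f * g) = aeval v f * T g + algebraMap k A (constantCoeff g) * T f

-- The matrices `!![v i, p i; 0, 0]` commute, so one can evaluate polynomials at them; `T` is the
-- upper right entry of the value.
lemma exists_isVirtualMul (v p : ι → A) (h : ∀ i j, v i * p j = v j * p i) :
    ∃ T : MvPolynomial ι k →ₗ[k] A, IsVirtualMul v p T := by
  let s : Set (Matrix (Fin 2) (Fin 2) A) := Set.range fun i => !![v i, p i; 0, 0]
  have hs : ∀ a ∈ s, ∀ b ∈ s, a * b = b * a := by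
    rintro _ ⟨i, rfl⟩ _ ⟨j, rfl⟩
    simp [h i j, mul_comm]
  let _ : CommRing (Algebra.adjoin k s) :=
    { (inferInstance : Ring (Algebra.adjoin k s)) with
      mul_comm := (Algebra.isMulCommutative_adjoin k hs).is_comm.comm }
  let F : MvPolynomial ι k →ₐ[k] Matrix (Fin 2) (Fin 2) A :=
    (Algebra.adjoin k s).val.comp (aeval fun i => ⟨_, Algebra.subset_adjoin ⟨i, rfl⟩⟩)
  have hFX : ∀ i, F (X i) = !![v i, p i; 0, 0] := fun i => by simp [F]
  have hF : ∀ f, F f 0 0 = aeval v f ∧ F f 1 1 = algebraMap k A (constantCoeff f) := by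
    suffices ∀ f, F f 0 0 = aeval v f ∧ F f 1 0 = 0 ∧ F f 1 1 = algebraMap k A (constantCoeff f)
      from fun f => ⟨(this f).1, (this f).2.2⟩
    intro f
    induction f using MvPolynomial.induction_on with
    | C a => simp [algHom_C, Matrix.algebraMap_matrix_apply]
    | add f g hf hg => simp [hf, hg]
    | mul_X f i hf => simp [Matrix.mul_apply, Fin.sum_univ_two, hFX, hf]
  refine ⟨{ toFun f := F f 0 1, map_add' f g := by simp, map_smul' a f := by simp },
    fun i => by simp [hFX], fun f g => ?_⟩
  simp only [LinearMap.coe_mk, AddHom.coe_mk, map_mul, Matrix.mul_apply, Fin.sum_univ_two, hF]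
  ring

namespace IsVirtualMul

variable {v p : ι → A} {T : MvPolynomial ι k →ₗ[k] A}

lemma apply_mul_of_constantCoeff_eq_zero (hT : IsVirtualMul v p T) (f : MvPolynomial ι k)
    {g : MvPolynomial ι k} (hg : constantCoeff g = 0) : T (f * g) = aeval v f * T g := by
  rw [hT.apply_mul, hg, map_zero, zero_mul, add_zero]

lemma apply_mul_X (hT : IsVirtualMul v p T) (f : MvPolynomial ι k) (i : ι) :
    T (f * X i) = aeval v f * p i := by
  rw [hT.apply_mul_of_constantCoeff_eq_zero f (constantCoeff_X _ i), hT.apply_X]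

variable [Fintype ι]

lemma apply_mulVec {κ : Type*} (hT : IsVirtualMul v p T) (M : Matrix κ ι (MvPolynomial ι k))
    {u : ι → MvPolynomial ι k} (hu : ∀ j, constantCoeff (u j) = 0) (m : κ) :
    T ((M *ᵥ u) m) = ∑ j, aeval v (M m j) * T (u j) := by
  rw [mulVec, dotProduct, map_sum]
  exact Finset.sum_congr rfl fun j _ => hT.apply_mul_of_constantCoeff_eq_zero _ (hu j)

end IsVirtualMul

variable [Fintype ι] {κ : Type*}

lemma constantCoeff_mulVec (M : Matrix κ ι (MvPolynomial ι k)) {u : ι → MvPolynomial ι k}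
    (hu : ∀ j, constantCoeff (u j) = 0) (m : κ) : constantCoeff ((M *ᵥ u) m) = 0 := by
  rw [mulVec, dotProduct, map_sum]
  exact Finset.sum_eq_zero fun j _ => by rw [map_mul, hu, mul_zero]

lemma mem_idealOfVars_of_constantCoeff_eq_zero {R σ : Type*} [CommRing R] {f : MvPolynomial σ R}
    (hf : constantCoeff f = 0) : f ∈ idealOfVars σ R := by
  rw [← pow_one (idealOfVars σ R), mem_pow_idealOfVars_iff']
  intro u hu
  rwa [(Finsupp.degree_eq_zero_iff u).mp (Nat.lt_one_iff.mp hu)]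

lemma exists_eq_sum_mul_X {f : MvPolynomial ι k} (hf : constantCoeff f = 0) :
    ∃ a : ι → MvPolynomial ι k, f = ∑ i, a i * X i := by
  obtain ⟨a, ha⟩ :=
    Ideal.mem_span_range_iff_exists_fun.mp (mem_idealOfVars_of_constantCoeff_eq_zero hf)
  exact ⟨a, ha.symm⟩

/-- The relations `r *ᵥ X = 0` together with the relations that follow from them in an algebra with
an element `W` such that `X i * W = (c *ᵥ X) i` and `W ^ 2 = q`. -/
def extensionIdeal (r : Matrix κ ι (MvPolynomial ι k)) (c : Matrix ι ι (MvPolynomial ι k))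
    (q : MvPolynomial ι k) : Ideal (MvPolynomial ι k) :=
  Ideal.span (Set.range (r *ᵥ X) ∪
    (Set.range (fun ij : ι × ι => X ij.1 * (c *ᵥ X) ij.2 - X ij.2 * (c *ᵥ X) ij.1) ∪
      Set.range fun i => X i * q - (c *ᵥ c *ᵥ X) i))

variable {r : Matrix κ ι (MvPolynomial ι k)} {c : Matrix ι ι (MvPolynomial ι k)}
  {q : MvPolynomial ι k}

lemma constantCoeff_eq_zero_of_mem_extensionIdeal {g : MvPolynomial ι k}
    (hg : g ∈ extensionIdeal r c q) : constantCoeff g = 0 := by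
  suffices extensionIdeal r c q ≤ RingHom.ker (constantCoeff : MvPolynomial ι k →+* k) from this hg
  have hX := constantCoeff_X (R := k) (σ := ι)
  refine Ideal.span_le.mpr ?_
  rintro _ (⟨m, rfl⟩ | ⟨ij, rfl⟩ | ⟨i, rfl⟩) <;> rw [SetLike.mem_coe, RingHom.mem_ker]
  · exact constantCoeff_mulVec r hX m
  · simp
  · rw [map_sub, constantCoeff_mulVec c (constantCoeff_mulVec c hX)]
    simp

section Kernel

variable {v : ι → A} {T : MvPolynomial ι k →ₗ[k] A}
  (hv : ∀ g, aeval v g = 0 ↔ g ∈ extensionIdeal r c q)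
  (hT : IsVirtualMul v (fun i => aeval v ((c *ᵥ X) i)) T)

include hT

lemma IsVirtualMul.apply_mulVec_X (M : Matrix κ ι (MvPolynomial ι k)) (m : κ) :
    T ((M *ᵥ X) m) = aeval v ((M *ᵥ c *ᵥ X) m) := by
  rw [hT.apply_mulVec M (fun i => constantCoeff_X _ i), mulVec, dotProduct, map_sum]
  exact Finset.sum_congr rfl fun j _ => by rw [hT.apply_X, map_mul]

include hv

lemma IsVirtualMul.apply_virtualMul (i : ι) : T ((c *ᵥ X) i) = aeval v (X i * q) := by
  rw [hT.apply_mulVec_X, eq_comm, ← sub_eq_zero, ← map_sub, hv]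
  exact Ideal.subset_span (Or.inr (Or.inr ⟨i, rfl⟩))

lemma IsVirtualMul.eq_zero_of_mem (hr : ∀ m, (r *ᵥ c *ᵥ X) m ∈ extensionIdeal r c q)
    {g : MvPolynomial ι k} (hg : g ∈ extensionIdeal r c q) : T g = 0 := by
  have hX := constantCoeff_X (R := k) (σ := ι)
  induction hg using Submodule.span_induction with
  | mem g hg =>
    rcases hg with ⟨m, rfl⟩ | ⟨⟨i, j⟩, rfl⟩ | ⟨i, rfl⟩
    · rw [hT.apply_mulVec_X, hv]
      exact hr m
    · rw [map_sub, mul_comm (X i), mul_comm (X j), hT.apply_mul_X, hT.apply_mul_X, mul_comm,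
        sub_self]
    · rw [map_sub, mul_comm (X i), hT.apply_mul_X, hT.apply_mulVec c (constantCoeff_mulVec c hX),
        sub_eq_zero, mulVec, dotProduct, map_sum, Finset.mul_sum]
      refine Finset.sum_congr rfl fun j _ => ?_
      rw [hT.apply_virtualMul hv, map_mul, map_mul]
      ring
  | zero => exact map_zero T
  | add f g _ _ hf hg => rw [map_add, hf, hg, add_zero]
  | smul a g hg hg' =>
    rw [smul_eq_mul, hT.apply_mul_of_constantCoeff_eq_zero a
      (constantCoeff_eq_zero_of_mem_extensionIdeal hg), hg', mul_zero]

lemma IsVirtualMul.exists_aeval_eq {f : MvPolynomial ι k} (hf : constantCoeff f = 0) :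
    ∃ g, constantCoeff g = 0 ∧ aeval v g = T f ∧ T g = aeval v (q * f) := by
  have hX := constantCoeff_X (R := k) (σ := ι)
  obtain ⟨a, rfl⟩ := exists_eq_sum_mul_X hf
  refine ⟨∑ i, a i * (c *ᵥ X) i, ?_, ?_, ?_⟩
  · rw [map_sum]
    exact Finset.sum_eq_zero fun i _ => by rw [map_mul, constantCoeff_mulVec c hX, mul_zero]
  · simp only [map_sum, hT.apply_mul_X, map_mul]
  · rw [map_sum, Finset.mul_sum, map_sum]
    refine Finset.sum_congr rfl fun i _ => ?_
    rw [hT.apply_mul_of_constantCoeff_eq_zero _ (constantCoeff_mulVec c hX i),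
      hT.apply_virtualMul hv, ← map_mul]
    congr 1
    ring

/-- The ideal of the elements `f + g * W` of `k[X][W] / (W ^ 2 - q)` that vanish in the algebra
obtained from `A` by adjoining `W`. -/
def virtualKernel (hr : ∀ m, (r *ᵥ c *ᵥ X) m ∈ extensionIdeal r c q) :
    Ideal (QuadraticAlgebra (MvPolynomial ι k) q 0) where
  carrier := {s | constantCoeff s.im = 0 ∧ aeval v s.re + T s.im = 0}
  zero_mem' := by simp
  add_mem' {s t} hs ht := by
    refine ⟨by simp [hs.1, ht.1], ?_⟩
    rw [QuadraticAlgebra.re_add, QuadraticAlgebra.im_add, map_add, map_add]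
    linear_combination hs.2 + ht.2
  smul_mem' a s hs := by
    obtain ⟨g, hg0, hg, hTg⟩ := hT.exists_aeval_eq hv hs.1
    have hmem : s.re + g ∈ extensionIdeal r c q := by rw [← hv, map_add, hg, hs.2]
    have hre : constantCoeff s.re = 0 := by
      simpa [hg0] using constantCoeff_eq_zero_of_mem_extensionIdeal hmem
    have hTre : T s.re + T g = 0 := by rw [← map_add, hT.eq_zero_of_mem hv hr hmem]
    constructor
    · simp [hre, hs.1]
    · have hs2 := hs.2
      simp only [smul_eq_mul, QuadraticAlgebra.re_mul, QuadraticAlgebra.im_mul, map_add, zero_mul,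
        add_zero, hT.apply_mul_of_constantCoeff_eq_zero _ hre,
        hT.apply_mul_of_constantCoeff_eq_zero _ hs.1, map_mul] at hTg ⊢
      linear_combination aeval v a.re * hs2 + aeval v a.im * (hTre - hTg)

end Kernel

theorem exists_virtualKernel (hr : ∀ m, (r *ᵥ c *ᵥ X) m ∈ extensionIdeal r c q) :
    ∃ K : Ideal (QuadraticAlgebra (MvPolynomial ι k) q 0),
      (∀ i, ⟨-(c *ᵥ X) i, X i⟩ ∈ K) ∧ ∀ g, ⟨g, 0⟩ ∈ K ↔ g ∈ extensionIdeal r c q := by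
  let v (i : ι) : MvPolynomial ι k ⧸ extensionIdeal r c q := Ideal.Quotient.mk _ (X i)
  have hv (g) : aeval v g = 0 ↔ g ∈ extensionIdeal r c q := by
    rw [← MvPolynomial.mkₐ_eq_aeval]
    exact Ideal.Quotient.eq_zero_iff_mem
  have hcomm (i j : ι) : v i * aeval v ((c *ᵥ X) j) = v j * aeval v ((c *ᵥ X) i) := by
    rw [← aeval_X (R := k) v i, ← aeval_X (R := k) v j, ← map_mul, ← map_mul, ← sub_eq_zero,
      ← map_sub, hv]
    exact Ideal.subset_span (Or.inr (Or.inl ⟨(i, j), rfl⟩))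
  obtain ⟨T, hT⟩ := exists_isVirtualMul (k := k) v _ hcomm
  refine ⟨virtualKernel hv hT hr, fun i => ⟨constantCoeff_X _ i, ?_⟩, fun g => ?_⟩
  · rw [map_neg, hT.apply_X, neg_add_cancel]
  · rw [← hv]
    exact ⟨fun h => by simpa using h.2, fun h => ⟨map_zero _, by simpa using h⟩⟩

theorem mem_extensionIdeal_of_forall (hr : ∀ m, (r *ᵥ c *ᵥ X) m ∈ extensionIdeal r c q)
    {g : MvPolynomial ι k}
    (hg : ∀ (B : Type (max u w)) [CommRing B] [Algebra k B] (v : ι → B) (W : B),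
      (∀ m, aeval v ((r *ᵥ X) m) = 0) → (∀ i, v i * W = aeval v ((c *ᵥ X) i)) →
      W * W = aeval v q → aeval v g = 0) :
    g ∈ extensionIdeal r c q := by
  obtain ⟨K, hKW, hK⟩ := exists_virtualKernel hr
  let F : MvPolynomial ι k →ₐ[k] QuadraticAlgebra (MvPolynomial ι k) q 0 ⧸ K :=
    (Ideal.Quotient.mkₐ k K).comp (IsScalarTower.toAlgHom k (MvPolynomial ι k) _)
  have hF (f) : F f = Ideal.Quotient.mk K ⟨f, 0⟩ := rfl
  have hF0 (f) : F f = 0 ↔ f ∈ extensionIdeal r c q := by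
    rw [hF, Ideal.Quotient.eq_zero_iff_mem, hK]
  have hv : aeval (fun i => F (X i)) = F := (aeval_unique F).symm
  rw [← hF0, ← hv]
  refine hg _ _ (Ideal.Quotient.mk K ⟨0, 1⟩) (fun m => ?_) (fun i => ?_) ?_ <;> rw [hv]
  · rw [hF0]
    exact Ideal.subset_span (Or.inl ⟨m, rfl⟩)
  · rw [hF, hF, ← map_mul, Ideal.Quotient.eq]
    convert hKW i using 1
    ext <;> simp
  · rw [hF, ← map_mul]
    congr 1
    ext <;> simp

lemma aeval_mulVec {B : Type*} [CommRing B] [Algebra k B] (M : Matrix κ ι (MvPolynomial ι k))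
    (v : ι → B) (f : ι → MvPolynomial ι k) (m : κ) :
    aeval v ((M *ᵥ f) m) = (M.map (aeval v) *ᵥ fun i => aeval v (f i)) m :=
  RingHom.map_mulVec (aeval v : MvPolynomial ι k →ₐ[k] B).toRingHom M f m

lemma aeval_eq_zero_of_mem_extensionIdeal {B : Type*} [CommRing B] [Algebra k B] {v : ι → B}
    (hr : r.map (aeval v) *ᵥ v = 0)
    (hc : ∀ i j, v i * (c.map (aeval v) *ᵥ v) j = v j * (c.map (aeval v) *ᵥ v) i)
    (hq : c.map (aeval v) *ᵥ c.map (aeval v) *ᵥ v = fun i => v i * aeval v q)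
    {g : MvPolynomial ι k} (hg : g ∈ extensionIdeal r c q) : aeval v g = 0 := by
  suffices extensionIdeal r c q ≤ RingHom.ker (aeval v : MvPolynomial ι k →ₐ[k] B) from this hg
  refine Ideal.span_le.mpr ?_
  rintro _ (⟨m, rfl⟩ | ⟨ij, rfl⟩ | ⟨i, rfl⟩) <;> rw [SetLike.mem_coe, RingHom.mem_ker]
  · simp only [aeval_mulVec, aeval_X, hr, Pi.zero_apply]
  · simp only [map_sub, map_mul, aeval_mulVec, aeval_X, hc ij.1, sub_self]
  · simp only [map_sub, map_mul, aeval_mulVec, aeval_X, hq, sub_self]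

end Extension

section Minors

open Matrix

variable {A A' : Type*} [CommRing A] [CommRing A'] {a b c : ℕ}

lemma det_submatrix_mem_minorsIdeal {t : ℕ} (M : Matrix (Fin a) (Fin b) A) (r : Fin t → Fin a)
    (s : Fin t → Fin b) : (M.submatrix r s).det ∈ minorsIdeal t M :=
  Ideal.subset_span ⟨r, s, rfl⟩

lemma map_minorsIdeal (f : A →+* A') (t : ℕ) (M : Matrix (Fin a) (Fin b) A) :
    (minorsIdeal t M).map f = minorsIdeal t (M.map f) := by
  rw [minorsIdeal, minorsIdeal, Ideal.map_span]
  congr 1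
  ext d
  constructor
  · rintro ⟨_, ⟨r, s, rfl⟩, rfl⟩
    exact ⟨r, s, RingHom.map_det f _⟩
  · rintro ⟨r, s, rfl⟩
    exact ⟨_, ⟨r, s, rfl⟩, RingHom.map_det f _⟩

lemma minorsIdeal_mul_left_le (t : ℕ) (N : Matrix (Fin c) (Fin a) A)
    (M : Matrix (Fin a) (Fin b) A) : minorsIdeal t (N * M) ≤ minorsIdeal t M := by
  refine Ideal.span_le.mpr ?_
  rintro _ ⟨r, s, rfl⟩
  have hrows : (N * M).submatrix r s = fun i => ∑ j, N (r i) j • fun l => M j (s l) := by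
    funext i l
    simp [mul_apply, Finset.sum_apply]
  have hdet : ((N * M).submatrix r s).det =
      ∑ f : Fin t → Fin a, (∏ i, N (r i) (f i)) • (M.submatrix f s).det := by
    refine (congrArg det hrows).trans ?_
    refine ((detRowAlternating (n := Fin t) (R := A)).toMultilinearMap.map_sum _).trans ?_
    exact Finset.sum_congr rfl fun f _ => MultilinearMap.map_smul_univ _ _ _
  rw [SetLike.mem_coe, hdet]
  exact Ideal.sum_mem _ fun f _ => Ideal.mul_mem_left _ _ (det_submatrix_mem_minorsIdeal M f s)

lemma minorsIdeal_transpose (t : ℕ) (M : Matrix (Fin a) (Fin b) A) :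
    minorsIdeal t Mᵀ = minorsIdeal t M := by
  rw [minorsIdeal, minorsIdeal]
  congr 1
  ext d
  exact ⟨fun ⟨r, s, hd⟩ => ⟨s, r, hd.trans (det_transpose _).symm⟩,
    fun ⟨r, s, hd⟩ => ⟨s, r, hd.trans (det_transpose _).symm⟩⟩

lemma minorsIdeal_mul_right_le (t : ℕ) (M : Matrix (Fin a) (Fin b) A)
    (N : Matrix (Fin b) (Fin c) A) : minorsIdeal t (M * N) ≤ minorsIdeal t M := by
  rw [← minorsIdeal_transpose, transpose_mul, ← minorsIdeal_transpose t M]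
  exact minorsIdeal_mul_left_le t _ _

end Minors

section Quadrics

open Matrix

variable {B : Type*} [CommRing B]

/-- The quadrics `xy`, `xz`, `yz`, `x² - z²`, `y² - z²`. -/
def quadrics (x : Fin 3 → B) : Fin 5 → B :=
  ![x 0 * x 1, x 0 * x 2, x 1 * x 2, x 0 * x 0 - x 2 * x 2, x 1 * x 1 - x 2 * x 2]

/-- The transpose of the Jacobian dual of the linear relations between the quadrics: the relations
are `quadricsDual T *ᵥ x`, with `T` in place of the quadrics. -/
def quadricsDual (T : Fin 5 → B) : Matrix (Fin 5) (Fin 3) B :=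
  !![T 2, 0, -T 0;
     T 2, -T 1, 0;
     -T 4, T 0, -T 1;
     T 0, -T 3, -T 2;
     T 1, -T 2, T 4 - T 3]

/-- The products of `x`, `y`, `z` with `z²` are `varMulSq x *ᵥ quadrics x`. -/
def varMulSq (x : Fin 3 → B) : Matrix (Fin 3) (Fin 5) B :=
  !![0, x 2, 0, 0, 0;
     0, 0, x 2, 0, 0;
     0, x 0, 0, -x 2, 0]

/-- The products of the quadrics with `z²` are `quadricsMulSq (quadrics x) *ᵥ quadrics x`. -/
def quadricsMulSq (T : Fin 5 → B) : Matrix (Fin 5) (Fin 5) B :=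
  !![0, 0, T 1, 0, 0;
     0, 0, T 0, 0, -T 1;
     0, T 0, 0, -T 2, 0;
     T 0, 0, -T 2, 0, -T 3;
     T 0, -T 1, 0, -T 4, 0]

/-- An expression for the square of `z²` in terms of the quadrics. -/
def sqSq (T : Fin 5 → B) : B := T 1 * T 1 + T 2 * T 2 - T 0 * T 0 + T 3 * T 4

/-- The symmetric matrix of the products of the variables, in terms of the quadrics and `W = z²`. -/
def symbolMatrix (T : Fin 5 → B) (W : B) : Matrix (Fin 3) (Fin 3) B :=
  !![T 3 + W, T 0, T 1; T 0, T 4 + W, T 2; T 1, T 2, W]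

variable {x : Fin 3 → B} {T : Fin 5 → B} {W : B}

lemma quadricsDual_mulVec (x : Fin 3 → B) (T : Fin 5 → B) : quadricsDual T *ᵥ x =
    ![T 2 * x 0 - T 0 * x 2, T 2 * x 0 - T 1 * x 1, -T 4 * x 0 + T 0 * x 1 - T 1 * x 2,
      T 0 * x 0 - T 3 * x 1 - T 2 * x 2, T 1 * x 0 - T 2 * x 1 + (T 4 - T 3) * x 2] := by
  ext i
  fin_cases i <;> simp [quadricsDual, mulVec, dotProduct, Fin.sum_univ_three] <;> ring

lemma varMulSq_mulVec (x : Fin 3 → B) (T : Fin 5 → B) :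
    varMulSq x *ᵥ T = ![x 2 * T 1, x 2 * T 2, x 0 * T 1 - x 2 * T 3] := by
  ext i
  fin_cases i <;> simp [varMulSq, mulVec, dotProduct, Fin.sum_univ_five]; ring

lemma quadricsMulSq_mulVec (T T' : Fin 5 → B) : quadricsMulSq T *ᵥ T' =
    ![T 1 * T' 2, T 0 * T' 2 - T 1 * T' 4, T 0 * T' 1 - T 2 * T' 3,
      T 0 * T' 0 - T 2 * T' 2 - T 3 * T' 4, T 0 * T' 0 - T 1 * T' 1 - T 4 * T' 3] := by
  ext i
  fin_cases i <;> simp [quadricsMulSq, mulVec, dotProduct, Fin.sum_univ_five] <;> ring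

lemma quadricsDual_mulVec_eq_zero_iff : quadricsDual T *ᵥ x = 0 ↔
    T 2 * x 0 - T 0 * x 2 = 0 ∧ T 2 * x 0 - T 1 * x 1 = 0 ∧ -T 4 * x 0 + T 0 * x 1 - T 1 * x 2 = 0 ∧
      T 0 * x 0 - T 3 * x 1 - T 2 * x 2 = 0 ∧ T 1 * x 0 - T 2 * x 1 + (T 4 - T 3) * x 2 = 0 := by
  rw [quadricsDual_mulVec, funext_iff]
  simp [Fin.forall_fin_succ]

lemma minors_quadricsDual_eq_zero (h : minorsIdeal 3 (quadricsDual T) = ⊥) :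
    T 1 ^ 2 * T 2 - T 0 ^ 2 * T 2 + T 0 * T 1 * T 4 = 0 ∧
    T 1 * T 2 ^ 2 + T 0 * T 2 * T 3 - T 0 ^ 2 * T 1 = 0 ∧
    T 0 * T 1 ^ 2 - T 0 * T 2 ^ 2 + T 1 * T 2 * (T 4 - T 3) = 0 ∧
    T 0 ^ 3 - T 0 * T 2 ^ 2 - T 1 * T 2 * T 3 - T 0 * T 3 * T 4 = 0 ∧
    T 0 ^ 2 * T 2 - T 2 ^ 3 - T 0 * T 1 * T 3 - T 2 * T 3 * (T 4 - T 3) = 0 ∧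
    T 1 ^ 3 - T 1 * T 2 ^ 2 + T 0 * T 2 * (T 4 - T 3) - T 1 * T 4 * (T 4 - T 3) = 0 ∧
    T 2 ^ 2 * T 4 - T 1 ^ 2 * T 3 - T 0 ^ 2 * (T 4 - T 3) + T 3 * T 4 * (T 4 - T 3) = 0 := by
  have hdet (a b c : Fin 5) : ((quadricsDual T).submatrix ![a, b, c] id).det = 0 := by
    rw [← Ideal.mem_bot, ← h]
    exact det_submatrix_mem_minorsIdeal _ _ _
  simp only [det_fin_three, submatrix_apply, id, cons_val] at hdet
  have m012 := hdet 0 1 2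
  have m013 := hdet 0 1 3
  have m014 := hdet 0 1 4
  have m023 := hdet 0 2 3
  have m034 := hdet 0 3 4
  have m124 := hdet 1 2 4
  have m234 := hdet 2 3 4
  simp only [quadricsDual, of_apply, cons_val] at m012 m013 m014 m023 m034 m124 m234
  clear h hdet
  refine ⟨?_, ?_, ?_, ?_, ?_, ?_, ?_⟩ <;> grind

lemma quadricsDual_mulVec_varMulSq (h : quadricsDual T *ᵥ x = 0) :
    quadricsDual T *ᵥ varMulSq x *ᵥ T = 0 := by
  obtain ⟨l0, l1, l2, l3, l4⟩ := quadricsDual_mulVec_eq_zero_iff.mp h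
  rw [varMulSq_mulVec, quadricsDual_mulVec_eq_zero_iff]
  simp only [cons_val]
  clear h
  refine ⟨?_, ?_, ?_, ?_, ?_⟩ <;> grind

lemma var_mul_varMulSq_comm (h : quadricsDual T *ᵥ x = 0) (i j : Fin 3) :
    x i * (varMulSq x *ᵥ T) j = x j * (varMulSq x *ᵥ T) i := by
  obtain ⟨l0, l1, l2, l3, l4⟩ := quadricsDual_mulVec_eq_zero_iff.mp h
  clear h
  rw [varMulSq_mulVec]
  fin_cases i <;> fin_cases j <;>
    simp only [Fin.zero_eta, Fin.mk_one, Fin.reduceFinMk, cons_val] <;> grind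

lemma var_mul_quadricsMulSq_comm (h : quadricsDual T *ᵥ x = 0) (i : Fin 3) (j : Fin 5) :
    x i * (quadricsMulSq T *ᵥ T) j = T j * (varMulSq x *ᵥ T) i := by
  obtain ⟨l0, l1, l2, l3, l4⟩ := quadricsDual_mulVec_eq_zero_iff.mp h
  clear h
  rw [varMulSq_mulVec, quadricsMulSq_mulVec]
  fin_cases i <;> fin_cases j <;>
    simp only [Fin.zero_eta, Fin.mk_one, Fin.reduceFinMk, cons_val] <;> grind

lemma quadric_mul_quadricsMulSq_comm (h : minorsIdeal 3 (quadricsDual T) = ⊥) (i j : Fin 5) :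
    T i * (quadricsMulSq T *ᵥ T) j = T j * (quadricsMulSq T *ᵥ T) i := by
  obtain ⟨m0, m1, m2, m3, m4, m5, m6⟩ := minors_quadricsDual_eq_zero h
  clear h
  rw [quadricsMulSq_mulVec]
  fin_cases i <;> fin_cases j <;>
    simp only [Fin.zero_eta, Fin.mk_one, Fin.reduceFinMk, cons_val] <;> grind

lemma var_mul_sqSq (h : quadricsDual T *ᵥ x = 0) :
    varMulSq x *ᵥ quadricsMulSq T *ᵥ T = fun i => x i * sqSq T := by
  obtain ⟨l0, l1, l2, l3, l4⟩ := quadricsDual_mulVec_eq_zero_iff.mp h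
  clear h
  rw [varMulSq_mulVec, quadricsMulSq_mulVec]
  ext i
  fin_cases i <;> simp only [Fin.zero_eta, Fin.mk_one, Fin.reduceFinMk, cons_val, sqSq] <;> grind

lemma quadric_mul_sqSq (h : minorsIdeal 3 (quadricsDual T) = ⊥) :
    quadricsMulSq T *ᵥ quadricsMulSq T *ᵥ T = fun i => T i * sqSq T := by
  obtain ⟨m0, m1, -, m3, -, -, -⟩ := minors_quadricsDual_eq_zero h
  clear h
  rw [quadricsMulSq_mulVec, quadricsMulSq_mulVec]
  ext i
  fin_cases i <;> simp only [Fin.zero_eta, Fin.mk_one, Fin.reduceFinMk, cons_val, sqSq] <;> grind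

lemma symbolMatrix_symm (T : Fin 5 → B) (W : B) (i j : Fin 3) :
    symbolMatrix T W i j = symbolMatrix T W j i := by
  fin_cases i <;> fin_cases j <;> rfl

lemma var_mul_symbolMatrix (hx : quadricsDual T *ᵥ x = 0)
    (hxW : ∀ i, x i * W = (varMulSq x *ᵥ T) i) (i j l : Fin 3) :
    x i * symbolMatrix T W j l = x j * symbolMatrix T W i l := by
  obtain ⟨l0, l1, l2, l3, l4⟩ := quadricsDual_mulVec_eq_zero_iff.mp hx
  have w0 := hxW 0
  have w1 := hxW 1
  have w2 := hxW 2
  simp only [varMulSq_mulVec, cons_val] at w0 w1 w2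
  clear hx hxW
  fin_cases i <;> fin_cases j <;> try rfl
  all_goals
    fin_cases l <;>
    simp only [Fin.zero_eta, Fin.mk_one, Fin.reduceFinMk, symbolMatrix, of_apply, cons_val] <;>
    grind

lemma symbolMatrix_mul_symbolMatrix (hTW : ∀ i, T i * W = (quadricsMulSq T *ᵥ T) i)
    (hWW : W * W = sqSq T) (i j l m : Fin 3) :
    symbolMatrix T W i j * symbolMatrix T W l m = symbolMatrix T W i l * symbolMatrix T W j m := by
  wlog him : i ≤ m generalizing i m
  · rw [symbolMatrix_symm T W i j, symbolMatrix_symm T W l m, symbolMatrix_symm T W i l,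
      symbolMatrix_symm T W j m, mul_comm, mul_comm (symbolMatrix T W l i)]
    exact (this m i (le_of_not_ge him)).symm
  wlog hjl : j < l generalizing j l
  · rcases (not_lt.mp hjl).lt_or_eq with hlj | rfl
    · exact (this l j hlj).symm
    · rfl
  have w0 := hTW 0
  have w1 := hTW 1
  have w2 := hTW 2
  have w3 := hTW 3
  have w4 := hTW 4
  simp only [quadricsMulSq_mulVec, cons_val] at w0 w1 w2 w3 w4
  rw [sqSq] at hWW
  clear hTW
  fin_cases j <;> fin_cases l <;> try exact absurd hjl (by decide)
  all_goals
    fin_cases i <;> fin_cases m <;> try exact absurd him (by decide)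
  all_goals
    simp only [Fin.zero_eta, Fin.mk_one, Fin.reduceFinMk, symbolMatrix, of_apply, cons_val]
    grind

lemma veroneseRelations_symbolMatrix (hx : quadricsDual T *ᵥ x = 0)
    (hxW : ∀ i, x i * W = (varMulSq x *ᵥ T) i) (hTW : ∀ i, T i * W = (quadricsMulSq T *ᵥ T) i)
    (hWW : W * W = sqSq T) : VeroneseRelations x (symbolMatrix T W) where
  symm := symbolMatrix_symm T W
  linear := var_mul_symbolMatrix hx hxW
  quadratic := symbolMatrix_mul_symbolMatrix hTW hWW

end Quadrics

section ReesGens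

open Matrix

section Map

variable {B B' F : Type*} [CommRing B] [CommRing B'] [FunLike F B B'] [RingHomClass F B B'] (f : F)

lemma map_quadricsDual (T : Fin 5 → B) : (quadricsDual T).map f = quadricsDual (f ∘ T) := by
  ext i j
  fin_cases i <;> fin_cases j <;> simp [quadricsDual]

lemma map_varMulSq (x : Fin 3 → B) : (varMulSq x).map f = varMulSq (f ∘ x) := by
  ext i j
  fin_cases i <;> fin_cases j <;> simp [varMulSq]

lemma map_quadricsMulSq (T : Fin 5 → B) :
    (quadricsMulSq T).map f = quadricsMulSq (f ∘ T) := by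
  ext i j
  fin_cases i <;> fin_cases j <;> simp [quadricsMulSq]

lemma map_sqSq (T : Fin 5 → B) : f (sqSq T) = sqSq (f ∘ T) := by
  simp only [sqSq, map_sub, map_add, map_mul, Function.comp_apply]

end Map

variable (k : Type*) [CommRing k]

/-- The generators `x`, `y`, `z` and `f t`, for the quadrics `f`, of the Rees algebra. -/
def reesGens : Fin 3 ⊕ Fin 5 → Polynomial (MvPolynomial (Fin 3) k) :=
  Sum.elim (fun i => Polynomial.C (X i)) fun j => Polynomial.monomial 1 (quadrics X j)

variable {k} {B : Type*} [CommRing B] [Algebra k B] {x : Fin 3 → B} {T : Fin 5 → B} {W : B}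

lemma VeroneseRelations.aeval_eq_zero_of_aeval_reesGens
    (h : VeroneseRelations x (symbolMatrix T W)) {g : MvPolynomial (Fin 3 ⊕ Fin 5) k}
    (hg : aeval (reesGens k) g = 0) : aeval (Sum.elim x T) g = 0 := by
  let S : Fin 3 → Fin 3 → MvPolynomial (Fin 3 ⊕ Fin 3 × Fin 3) k := fun i j => X (Sum.inr (i, j))
  let e : MvPolynomial (Fin 3 ⊕ Fin 5) k →ₐ[k] MvPolynomial (Fin 3 ⊕ Fin 3 × Fin 3) k :=
    aeval (Sum.elim (fun i => X (Sum.inl i))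
      ![S 0 1, S 0 2, S 1 2, S 0 0 - S 2 2, S 1 1 - S 2 2])
  have hrees : (veroneseMap (Fin 3) k).comp e = aeval (reesGens k) := by
    ext1 (i | j)
    · simp [e, veroneseMap, reesGens]
    · fin_cases j <;> simp [e, S, veroneseMap, reesGens, quadrics]
  have heval : (aeval (Sum.elim x fun ij => symbolMatrix T W ij.1 ij.2)).comp e =
      aeval (Sum.elim x T) := by
    ext1 (i | j)
    · simp [e]
    · fin_cases j <;> simp [e, S, symbolMatrix]
  rw [← hrees, AlgHom.comp_apply] at hg
  rw [← heval, AlgHom.comp_apply, h.aeval_eq_zero_of_veroneseMap_eq_zero hg]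

/-- The matrix that expresses the products of `z²` with the generators `x, T` of the Rees algebra
in terms of these generators. -/
def mulSq (x : Fin 3 → B) (T : Fin 5 → B) : Matrix (Fin 3 ⊕ Fin 5) (Fin 3 ⊕ Fin 5) B :=
  fromBlocks 0 (varMulSq x) 0 (quadricsMulSq T)

lemma mulSq_mulVec (x x' : Fin 3 → B) (T T' : Fin 5 → B) : mulSq x T *ᵥ Sum.elim x' T' =
    Sum.elim (varMulSq x *ᵥ T') (quadricsMulSq T *ᵥ T') := by
  simp [mulSq, fromBlocks_mulVec]

lemma mul_mulSq_mulVec_comm (hx : quadricsDual T *ᵥ x = 0)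
    (hT : minorsIdeal 3 (quadricsDual T) = ⊥) (i j : Fin 3 ⊕ Fin 5) :
    Sum.elim x T i * (mulSq x T *ᵥ Sum.elim x T) j =
      Sum.elim x T j * (mulSq x T *ᵥ Sum.elim x T) i := by
  rw [mulSq_mulVec]
  rcases i with i | i <;> rcases j with j | j
  · exact var_mul_varMulSq_comm hx i j
  · exact var_mul_quadricsMulSq_comm hx i j
  · exact (var_mul_quadricsMulSq_comm hx j i).symm
  · exact quadric_mul_quadricsMulSq_comm hT i j

lemma mulSq_mulVec_mulSq_mulVec (hx : quadricsDual T *ᵥ x = 0)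
    (hT : minorsIdeal 3 (quadricsDual T) = ⊥) :
    mulSq x T *ᵥ mulSq x T *ᵥ Sum.elim x T = fun i => Sum.elim x T i * sqSq T := by
  rw [mulSq_mulVec, mulSq_mulVec, var_mul_sqSq hx, quadric_mul_sqSq hT]
  ext (i | i) <;> rfl

variable (k) in
/-- The ideal of relations between the generators `reesGens` of the Rees algebra. -/
def reesGensIdeal : Ideal (MvPolynomial (Fin 3 ⊕ Fin 5) k) :=
  extensionIdeal (fromCols (quadricsDual (X ∘ Sum.inr)) 0) (mulSq (X ∘ Sum.inl) (X ∘ Sum.inr))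
    (sqSq (X ∘ Sum.inr))

section Map

variable {B' F : Type*} [CommRing B'] [FunLike F B B'] [RingHomClass F B B'] (f : F)

lemma map_mulSq (x : Fin 3 → B) (T : Fin 5 → B) :
    (mulSq x T).map f = mulSq (f ∘ x) (f ∘ T) := by
  rw [mulSq, mulSq, fromBlocks_map, map_varMulSq, map_quadricsMulSq, Matrix.map_zero _ (map_zero f),
    Matrix.map_zero _ (map_zero f)]

lemma map_fromCols_quadricsDual (T : Fin 5 → B) :
    (fromCols (quadricsDual T) (0 : Matrix (Fin 5) (Fin 5) B)).map f =
      fromCols (quadricsDual (f ∘ T)) 0 := by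
  rw [fromCols_map, map_quadricsDual, Matrix.map_zero _ (map_zero f)]

end Map

lemma fromCols_quadricsDual_mulVec (x : Fin 3 → B) (T T' : Fin 5 → B) :
    fromCols (quadricsDual T) 0 *ᵥ Sum.elim x T' = quadricsDual T *ᵥ x := by
  rw [fromCols_mulVec_sumElim, zero_mulVec, add_zero]

lemma aeval_comp_X {R σ B : Type*} [CommSemiring R] [CommSemiring B] [Algebra R B] (v : σ → B) :
    ⇑(aeval (R := R) v) ∘ X = v :=
  funext fun i => aeval_X v i

lemma aeval_comp_X_comp {ι κ : Type*} (v : ι → B) (f : κ → ι) :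
    ⇑(aeval (R := k) v) ∘ X ∘ f = v ∘ f := by
  rw [← Function.comp_assoc, aeval_comp_X]

lemma quadricsDual_mulVec_mem_reesGensIdeal (m : Fin 5) :
    (fromCols (quadricsDual (X ∘ Sum.inr)) 0 *ᵥ mulSq (X ∘ Sum.inl) (X ∘ Sum.inr) *ᵥ X) m ∈
      reesGensIdeal k := by
  let π := Ideal.Quotient.mk (reesGensIdeal k)
  have hmap {κ ι : Type} [Fintype ι] (M : Matrix κ ι (MvPolynomial (Fin 3 ⊕ Fin 5) k))
      (f : ι → MvPolynomial (Fin 3 ⊕ Fin 5) k) : π ∘ (M *ᵥ f) = M.map π *ᵥ π ∘ f :=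
    funext fun l => RingHom.map_mulVec π M f l
  have hx : quadricsDual (π ∘ X ∘ Sum.inr) *ᵥ (π ∘ X ∘ Sum.inl) = 0 := by
    rw [← map_quadricsDual, ← hmap, ← fromCols_quadricsDual_mulVec _ _ (X ∘ Sum.inr),
      Sum.elim_comp_inl_inr]
    exact funext fun l => Ideal.Quotient.eq_zero_iff_mem.mpr (Ideal.subset_span (Or.inl ⟨l, rfl⟩))
  have hmul := quadricsDual_mulVec_varMulSq hx
  rw [← map_varMulSq, ← hmap, ← map_quadricsDual, ← hmap] at hmul
  rw [← Ideal.Quotient.eq_zero_iff_mem, ← Sum.elim_comp_inl_inr X, mulSq_mulVec,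
    fromCols_quadricsDual_mulVec]
  exact congrFun hmul m

lemma mem_reesGensIdeal_of_aeval_eq_zero {g : MvPolynomial (Fin 3 ⊕ Fin 5) k}
    (hg : aeval (reesGens k) g = 0) : g ∈ reesGensIdeal k := by
  refine mem_extensionIdeal_of_forall quadricsDual_mulVec_mem_reesGensIdeal
    fun B _ _ v W hv hW hWW => ?_
  obtain ⟨x, T, rfl⟩ : ∃ x T, Sum.elim x T = v := ⟨_, _, Sum.elim_comp_inl_inr v⟩
  simp only [aeval_mulVec, aeval_X, map_fromCols_quadricsDual, aeval_comp_X_comp,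
    Sum.elim_comp_inr, fromCols_quadricsDual_mulVec] at hv
  simp only [aeval_mulVec, aeval_X, map_mulSq, aeval_comp_X_comp,
    Sum.elim_comp_inl, Sum.elim_comp_inr, mulSq_mulVec] at hW
  rw [map_sqSq, aeval_comp_X_comp, Sum.elim_comp_inr] at hWW
  exact (veroneseRelations_symbolMatrix (funext hv) (fun i => hW (Sum.inl i))
    (fun i => hW (Sum.inr i)) hWW).aeval_eq_zero_of_aeval_reesGens hg

theorem aeval_eq_zero_of_quadricsDual (hx : quadricsDual T *ᵥ x = 0)
    (hT : minorsIdeal 3 (quadricsDual T) = ⊥) {g : MvPolynomial (Fin 3 ⊕ Fin 5) k}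
    (hg : aeval (reesGens k) g = 0) : aeval (Sum.elim x T) g = 0 := by
  have hc : (mulSq (X ∘ Sum.inl) (X ∘ Sum.inr)).map (aeval (R := k) (Sum.elim x T)) =
      mulSq x T := by
    rw [map_mulSq, aeval_comp_X_comp, aeval_comp_X_comp, Sum.elim_comp_inl, Sum.elim_comp_inr]
  refine aeval_eq_zero_of_mem_extensionIdeal ?_ ?_ ?_ (mem_reesGensIdeal_of_aeval_eq_zero hg)
  · rw [map_fromCols_quadricsDual, aeval_comp_X_comp, Sum.elim_comp_inr,
      fromCols_quadricsDual_mulVec, hx]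
  · rw [hc]
    exact mul_mulSq_mulVec_comm hx hT
  · rw [hc, mulSq_mulVec_mulSq_mulVec hx hT, map_sqSq, aeval_comp_X_comp, Sum.elim_comp_inr]

end ReesGens

section Pfaffians

open Matrix

variable {A : Type*} [CommRing A] {φ : Matrix (Fin 5) (Fin 5) A}

lemma apply_self_eq_zero_of_transpose_eq_neg {ι : Type*} {φ : Matrix ι ι A} (h2 : IsUnit (2 : A))
    (hφ : φ.transpose = -φ) (i : ι) : φ i i = 0 := by
  have h : φ i i = -φ i i := congrFun (congrFun hφ i) i
  exact (h2.mul_right_eq_zero).mp (by linear_combination h)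

lemma pfaffians_eq (φ : Matrix (Fin 5) (Fin 5) A) : pfaffians φ =
    ![φ 1 2 * φ 3 4 - φ 1 3 * φ 2 4 + φ 1 4 * φ 2 3,
      -(φ 0 2 * φ 3 4 - φ 0 3 * φ 2 4 + φ 0 4 * φ 2 3),
      φ 0 1 * φ 3 4 - φ 0 3 * φ 1 4 + φ 0 4 * φ 1 3,
      -(φ 0 1 * φ 2 4 - φ 0 2 * φ 1 4 + φ 0 4 * φ 1 2),
      φ 0 1 * φ 2 3 - φ 0 2 * φ 1 3 + φ 0 3 * φ 1 2] := by
  have h (i : Fin 5) : pfaffians φ i = (-1) ^ (i : ℕ) * (φ (i.succAbove 0) (i.succAbove 1) *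
      φ (i.succAbove 2) (i.succAbove 3) - φ (i.succAbove 0) (i.succAbove 2) *
      φ (i.succAbove 1) (i.succAbove 3) + φ (i.succAbove 0) (i.succAbove 3) *
      φ (i.succAbove 1) (i.succAbove 2)) := rfl
  ext i
  rw [h]
  fin_cases i <;> simp [Fin.succAbove, Fin.lt_def, pow_succ]

lemma pfaffians_vecMul (hφ : φ.transpose = -φ) (hd : ∀ i, φ i i = 0) :
    pfaffians φ ᵥ* φ = 0 := by
  have hs (i j) : φ i j = -φ j i := congrFun (congrFun hφ j) i
  ext j
  rw [pfaffians_eq, vecMul, dotProduct, Fin.sum_univ_five]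
  simp only [cons_val]
  fin_cases j <;> simp only [Fin.zero_eta, Fin.mk_one, Fin.reduceFinMk, hd, Pi.zero_apply] <;> grind

lemma pfaffians_mul_comm_of_mulVec_eq_zero (hφ : φ.transpose = -φ) (hd : ∀ i, φ i i = 0)
    {v : Fin 5 → A} (hv : φ *ᵥ v = 0) (i j : Fin 5) :
    pfaffians φ i * v j = pfaffians φ j * v i := by
  have hs (i j) : φ i j = -φ j i := congrFun (congrFun hφ j) i
  have hv (i) : φ i 0 * v 0 + φ i 1 * v 1 + φ i 2 * v 2 + φ i 3 * v 3 + φ i 4 * v 4 = 0 := by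
    rw [← Fin.sum_univ_five fun j => φ i j * v j]
    exact congrFun hv i
  have v0 := hv 0
  have v1 := hv 1
  have v2 := hv 2
  have v3 := hv 3
  have v4 := hv 4
  simp only [hd, hs 1 0, hs 2 0, hs 3 0, hs 4 0, hs 2 1, hs 3 1, hs 4 1, hs 3 2, hs 4 2, hs 4 3]
    at v0 v1 v2 v3 v4
  wlog hij : i < j generalizing i j
  · rcases (not_lt.mp hij).eq_or_lt with rfl | hji
    · rfl
    · exact (this j i hji).symm
  rw [pfaffians_eq]
  clear hs hv hφ hd
  fin_cases i <;> fin_cases j <;> try exact absurd hij (by decide)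
  all_goals
    simp only [Fin.zero_eta, Fin.mk_one, Fin.reduceFinMk, cons_val]
    grind

lemma eq_zero_of_mulVec_algebraMap_eq_zero {k : Type*} [CommRing k] [Algebra k A]
    (hφ : φ.transpose = -φ) (hd : ∀ i, φ i i = 0) (hf : LinearIndependent k (pfaffians φ))
    {v : Fin 5 → k} (hv : φ *ᵥ (algebraMap k A ∘ v) = 0) : v = 0 := by
  ext j
  obtain ⟨i, hij⟩ := exists_ne j
  have hcomm : v j • pfaffians φ i + -v i • pfaffians φ j = 0 := by
    have := pfaffians_mul_comm_of_mulVec_eq_zero hφ hd hv i j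
    simp only [Function.comp_apply] at this
    rw [Algebra.smul_def, Algebra.smul_def, map_neg]
    linear_combination this
  exact (LinearIndepOn.pair_iff _ hij |>.mp (hf.linearIndepOn (s := {i, j})) _ _ hcomm).1

lemma isHomogeneous_pfaffians {k σ : Type*} [CommRing k]
    {φ : Matrix (Fin 5) (Fin 5) (MvPolynomial σ k)}
    (hφ : ∀ i j, (φ i j).IsHomogeneous 1) (i : Fin 5) : (pfaffians φ i).IsHomogeneous 2 := by
  have h (a b c d) : (φ a b * φ c d).IsHomogeneous 2 := (hφ a b).mul (hφ c d)
  rw [pfaffians_eq]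
  fin_cases i
  · exact ((h 1 2 3 4).sub (h 1 3 2 4)).add (h 1 4 2 3)
  · exact (((h 0 2 3 4).sub (h 0 3 2 4)).add (h 0 4 2 3)).neg
  · exact ((h 0 1 3 4).sub (h 0 3 1 4)).add (h 0 4 1 3)
  · exact (((h 0 1 2 4).sub (h 0 2 1 4)).add (h 0 4 1 2)).neg
  · exact ((h 0 1 2 3).sub (h 0 2 1 3)).add (h 0 3 1 2)

end Pfaffians

section ReesAlgebra

variable {A : Type*} [CommRing A] {m : ℕ}

lemma range_aeval_monomial (f : Fin m → A) :
    (aeval fun i => Polynomial.monomial 1 (f i) : MvPolynomial (Fin m) A →ₐ[A] _).range =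
      reesAlgebra (Ideal.span (Set.range f)) := by
  rw [← Algebra.adjoin_range_eq_range_aeval, ← adjoin_monomial_eq_reesAlgebra]
  refine le_antisymm (Algebra.adjoin_mono ?_) (Algebra.adjoin_le ?_)
  · rintro _ ⟨i, rfl⟩
    exact ⟨f i, Ideal.subset_span ⟨i, rfl⟩, rfl⟩
  · rintro _ ⟨a, ha, rfl⟩
    obtain ⟨c, rfl⟩ := Ideal.mem_span_range_iff_exists_fun.mp ha
    rw [map_sum]
    refine sum_mem fun i _ => ?_
    rw [← smul_eq_mul, map_smul]
    exact Subalgebra.smul_mem _ (Algebra.subset_adjoin (Set.mem_range_self i)) _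

lemma exists_equiv_reesAlgebra {f : Fin m → A} {I : Ideal A} (hI : Ideal.span (Set.range f) = I)
    {D : Ideal (MvPolynomial (Fin m) A)} (hD : D = reesIdeal f) :
    ∃ e : (MvPolynomial (Fin m) A ⧸ D) ≃ₐ[A] reesAlgebra I,
      ∀ i, (e (Ideal.Quotient.mk D (X i)) : Polynomial A) = Polynomial.monomial 1 (f i) := by
  subst hD hI
  exact ⟨(Ideal.quotientKerEquivRange _).trans (Subalgebra.equivOfEq _ _ (range_aeval_monomial f)),
    fun i => aeval_X (fun i => Polynomial.monomial 1 (f i)) i⟩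

end ReesAlgebra

section LinearForms

open Matrix

variable {k σ ι : Type*} [CommRing k] [Fintype σ]

lemma toMvPolynomial_eq_map_mulVec_X (m : Matrix ι σ k) :
    m.toMvPolynomial = m.map C *ᵥ (X : σ → MvPolynomial σ k) := by
  ext1 i
  simp only [toMvPolynomial, mulVec, dotProduct, map_apply, C_mul_X_eq_monomial]

lemma exists_toMvPolynomial_eq {y : ι → MvPolynomial σ k} (hy : ∀ i, (y i).IsHomogeneous 1) :
    ∃ m : Matrix ι σ k, m.toMvPolynomial = y := by
  have h (i) : ∃ c : σ → k, ∑ l, c l • X l = y i := by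
    have := (mem_homogeneousSubmodule 1 (y i)).mpr (hy i)
    rwa [homogeneousSubmodule_one_eq_span_X, Submodule.mem_span_range_iff_exists_fun] at this
  choose c hc using h
  refine ⟨of c, funext fun i => ?_⟩
  simp only [toMvPolynomial, of_apply, ← hc i, smul_eq_C_mul, C_mul_X_eq_monomial]

lemma pderiv_sum_C_mul_X (c : σ → k) (l : σ) : pderiv l (∑ i, C (c i) * X i) = C (c l) := by
  classical
  rw [map_sum, Finset.sum_eq_single l]
  · rw [pderiv_C_mul, pderiv_X_self, mul_one]
  · intro i _ hi
    rw [pderiv_C_mul, pderiv_X_of_ne hi, mul_zero]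
  · exact fun hl => absurd (Finset.mem_univ l) hl

lemma map_mulVec_toMvPolynomial [DecidableEq σ] {m n : Matrix σ σ k} (h : m * n = 1) :
    n.map C *ᵥ m.toMvPolynomial = X := by
  rw [toMvPolynomial_eq_map_mulVec_X, mulVec_mulVec, ← Matrix.map_mul, mul_eq_one_comm.mp h,
    Matrix.map_one _ C_0 C_1, one_mulVec]

lemma aeval_toMvPolynomial_leftInverse [DecidableEq σ] {m n : Matrix σ σ k} (h : m * n = 1) :
    Function.LeftInverse (aeval (R := k) n.toMvPolynomial) (aeval m.toMvPolynomial) := by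
  intro p
  rw [← AlgHom.comp_apply, comp_aeval]
  have hX (i) : aeval n.toMvPolynomial (m.toMvPolynomial i) = X i := by
    rw [aeval_eq_bind₁, ← toMvPolynomial_mul, h, toMvPolynomial_one]
  rw [funext hX, aeval_X_left, AlgHom.id_apply]

end LinearForms

section JacobianDual

open Matrix

lemma minorsIdeal_eq_bot_of_mulVec_eq_zero {A : Type*} [CommRing A] [IsDomain A] {a t : ℕ}
    {M : Matrix (Fin a) (Fin t) A} {v : Fin t → A} (hv : v ≠ 0) (h : M *ᵥ v = 0) :
    minorsIdeal t M = ⊥ := by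
  rw [eq_bot_iff, minorsIdeal, Ideal.span_le]
  rintro _ ⟨r, s, rfl⟩
  by_cases hs : Function.Injective s
  · let e := Equiv.ofBijective s (Finite.injective_iff_bijective.mp hs)
    refine exists_mulVec_eq_zero_iff.mp ⟨v ∘ e, fun hve => hv ?_, funext fun i => ?_⟩
    · simpa [Function.comp_assoc] using congrArg (· ∘ e.symm) hve
    · exact (e.sum_comp fun l => M (r i) l * v l).trans (congrFun h (r i))
  · obtain ⟨i, j, hij, hne⟩ := Function.not_injective_iff.mp hs
    exact det_zero_of_column_eq hne fun l => congrArg (M (r l)) hij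

lemma TMul_eq_vecMul {A : Type*} [CommRing A] {a b : ℕ} (φ : Matrix (Fin a) (Fin b) A) :
    TMul φ = X ᵥ* φ.map C :=
  rfl

lemma TMul_mem_reesIdeal {A : Type*} [CommRing A] {a b : ℕ} {φ : Matrix (Fin a) (Fin b) A}
    {f : Fin a → A} (hf : f ᵥ* φ = 0) (j : Fin b) : TMul φ j ∈ reesIdeal f := by
  have h : aeval (R := A) (fun i => Polynomial.monomial 1 (f i)) (TMul φ j) =
      Polynomial.monomial 1 ((f ᵥ* φ) j) := by
    simp only [TMul, vecMul, dotProduct, map_sum, map_mul, aeval_X, algHom_C,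
      Polynomial.algebraMap_apply, Algebra.algebraMap_self, RingHom.id_apply,
      Polynomial.monomial_mul_C]
  rw [reesIdeal, RingHom.mem_ker, h, hf, Pi.zero_apply, map_zero]

variable {k : Type*} [Field k] {n a b : ℕ} {φ : Matrix (Fin a) (Fin b) (MvPolynomial (Fin n) k)}

lemma coeff_xDeriv (l : Fin n) (P : MvPolynomial (Fin a) (MvPolynomial (Fin n) k))
    (e : Fin a →₀ ℕ) : coeff e (xDeriv l P) = pderiv l (coeff e P) := by
  classical
  rw [xDeriv, coeff_sum]
  simp only [coeff_monomial]
  rw [Finset.sum_ite_eq' P.support e]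
  split_ifs with h
  · rfl
  · rw [notMem_support_iff.mp h, map_zero]

lemma jacobianDual_eq_of_TMul_eq {M : Matrix (Fin b) (Fin n) (MvPolynomial (Fin a) k)}
    (h : TMul φ = M.map (map C) *ᵥ (C ∘ X)) : jacobianDual φ = M.map (map C) := by
  ext1 j l
  ext1 e
  have hcoeff : coeff e (TMul φ j) = ∑ i, C (coeff e (M j i)) * X i := by
    simp only [h, mulVec, dotProduct, map_apply, Function.comp_apply, coeff_sum, mul_comm _ (C _),
      coeff_C_mul, coeff_map]
  rw [jacobianDual, of_apply, coeff_xDeriv, hcoeff, map_apply, coeff_map, pderiv_sum_C_mul_X]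

lemma exists_TMul_eq (hφ : ∀ i j, (φ i j).IsHomogeneous 1) :
    ∃ M : Matrix (Fin b) (Fin n) (MvPolynomial (Fin a) k),
      TMul φ = M.map (map C) *ᵥ (C ∘ X) := by
  choose c hc using fun i => exists_toMvPolynomial_eq (hφ i)
  refine ⟨of fun j l => ∑ i, X i * C (c i j l), funext fun j => ?_⟩
  simp only [TMul, mulVec, dotProduct, map_apply, of_apply, Function.comp_apply, map_sum, map_mul,
    map_X, map_C, Finset.sum_mul]
  rw [Finset.sum_comm]
  refine Finset.sum_congr rfl fun i _ => ?_
  rw [← hc i, toMvPolynomial_eq_map_mulVec_X, mulVec, dotProduct, map_sum, Finset.mul_sum]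
  exact Finset.sum_congr rfl fun l _ => by rw [map_apply, map_mul, mul_assoc]

lemma jacobianDual_mulVec (hφ : ∀ i j, (φ i j).IsHomogeneous 1) :
    jacobianDual φ *ᵥ (C ∘ X) = TMul φ := by
  obtain ⟨M, hM⟩ := exists_TMul_eq hφ
  rw [jacobianDual_eq_of_TMul_eq hM, hM]

lemma dualIdeal_le_reesIdeal {φ : Matrix (Fin a) (Fin b) (MvPolynomial (Fin 3) k)}
    (hφ : ∀ i j, (φ i j).IsHomogeneous 1) {f : Fin a → MvPolynomial (Fin 3) k}
    (hf : f ᵥ* φ = 0) : dualIdeal φ ≤ reesIdeal f := by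
  let π : MvPolynomial (Fin a) (MvPolynomial (Fin 3) k) →ₐ[MvPolynomial (Fin 3) k]
    Polynomial (MvPolynomial (Fin 3) k) := aeval fun i => Polynomial.monomial 1 (f i)
  refine sup_le (Ideal.span_le.mpr ?_) ?_
  · rintro _ ⟨j, rfl⟩
    exact TMul_mem_reesIdeal hf j
  · change minorsIdeal 3 (jacobianDual φ) ≤ Ideal.comap π.toRingHom ⊥
    rw [← Ideal.map_le_iff_le_comap, map_minorsIdeal]
    refine (minorsIdeal_eq_bot_of_mulVec_eq_zero (v := π ∘ C ∘ X) (fun h => ?_) ?_).le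
    · have hX : Polynomial.C (X 0 : MvPolynomial (Fin 3) k) = 0 :=
        (algHom_C π (X 0)).symm.trans (congrFun h 0)
      exact X_ne_zero 0 (Polynomial.C_eq_zero.mp hX)
    · ext1 j
      refine (RingHom.map_mulVec π.toRingHom _ _ j).symm.trans ?_
      rw [jacobianDual_mulVec hφ]
      exact TMul_mem_reesIdeal hf j

lemma hasFiberTypeRelations_of_dualIdeal_eq (hφ : ∀ i j, (φ i j).IsHomogeneous 1)
    {f : Fin a → MvPolynomial (Fin n) k} (hf : dualIdeal φ = reesIdeal f) :
    HasFiberTypeRelations f := by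
  refine le_antisymm ?_ (sup_le (Ideal.span_le.mpr fun _ h => h.1)
    (Ideal.span_le.mpr fun _ h => h.1))
  nth_rw 1 [← hf]
  refine sup_le_sup (Ideal.span_mono ?_) (Ideal.span_mono ?_)
  · rintro _ ⟨j, rfl⟩
    refine ⟨hf ▸ Ideal.mem_sup_left (Ideal.subset_span ⟨j, rfl⟩), ?_⟩
    exact IsHomogeneous.sum _ _ _ fun i _ => (isHomogeneous_X _ i).mul (isHomogeneous_C _ (φ i j))
  · rintro _ ⟨r, c, rfl⟩
    refine ⟨hf ▸ Ideal.mem_sup_right (det_submatrix_mem_minorsIdeal _ r c), ?_⟩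
    obtain ⟨M, hM⟩ := exists_TMul_eq hφ
    refine ⟨(M.submatrix r c).det, ?_⟩
    rw [jacobianDual_eq_of_TMul_eq hM, RingHom.map_det]
    rfl

end JacobianDual

section Forms

open Matrix

variable {k σ ι : Type*} [Field k] [Fintype ι] {d : ℕ} {f g : ι → MvPolynomial σ k}

lemma homogeneousComponent_mul_of_isHomogeneous {p : MvPolynomial σ k} (hp : p.IsHomogeneous d)
    (q : MvPolynomial σ k) : homogeneousComponent d (q * p) = C (constantCoeff q) * p := by
  classical
  induction q using MvPolynomial.induction_on' with
  | add q r hq hr => rw [add_mul, map_add, hq, hr, map_add, map_add, add_mul]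
  | monomial u a =>
    rw [homogeneousComponent_of_mem ((isHomogeneous_monomial (n := u.degree) a rfl).mul hp)]
    by_cases hu : u = 0
    · rw [hu, map_zero, zero_add, if_pos rfl, ← C_apply, constantCoeff_C]
    · have : u.degree ≠ 0 := mt u.degree_eq_zero_iff.mp hu
      rw [if_neg (by omega), constantCoeff_monomial, if_neg hu, map_zero, zero_mul]

lemma exists_map_mulVec_eq_of_span_le {κ : Type*} {f : κ → MvPolynomial σ k}
    (hf : ∀ i, (f i).IsHomogeneous d) (hg : ∀ i, (g i).IsHomogeneous d)
    (h : Ideal.span (Set.range f) ≤ Ideal.span (Set.range g)) :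
    ∃ P : Matrix κ ι k, f = P.map C *ᵥ g := by
  choose c hc using fun i =>
    Ideal.mem_span_range_iff_exists_fun.mp (h (Ideal.subset_span (Set.mem_range_self i)))
  refine ⟨of fun i j => constantCoeff (c i j), funext fun i => ?_⟩
  rw [← homogeneousComponent_eq_self (hf i), ← hc i, map_sum]
  exact Finset.sum_congr rfl fun j _ => homogeneousComponent_mul_of_isHomogeneous (hg j) _

lemma linearIndependent_iff_dotProduct {A : Type*} [CommRing A] [Algebra k A] {g : ι → A} :
    LinearIndependent k g ↔ ∀ c : ι → k, (algebraMap k A ∘ c) ⬝ᵥ g = 0 → c = 0 := by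
  simp only [Fintype.linearIndependent_iff, dotProduct, Function.comp_apply, Algebra.smul_def,
    funext_iff, Pi.zero_apply]

lemma eq_of_map_mulVec_eq {κ : Type*} {M N : Matrix κ ι k} (hg : LinearIndependent k g)
    (h : M.map C *ᵥ g = N.map C *ᵥ g) : M = N := by
  ext1 i
  refine congrFun (sub_eq_zero.mp (linearIndependent_iff_dotProduct.mp hg (M i - N i) ?_))
  have hcomp : algebraMap k (MvPolynomial σ k) ∘ (M i - N i) = M.map C i - N.map C i :=
    funext fun j => map_sub C (M i j) (N i j)
  rw [hcomp, sub_dotProduct]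
  exact sub_eq_zero.mpr (congrFun h i)

lemma exists_inverse_matrices_of_span_eq [DecidableEq ι] (hf : ∀ i, (f i).IsHomogeneous d)
    (hg : ∀ i, (g i).IsHomogeneous d) (h : Ideal.span (Set.range f) = Ideal.span (Set.range g))
    (hli : LinearIndependent k g) :
    ∃ P Q : Matrix ι ι k, P * Q = 1 ∧ g = P.map C *ᵥ f ∧ f = Q.map C *ᵥ g := by
  obtain ⟨P, hP⟩ := exists_map_mulVec_eq_of_span_le hg hf h.ge
  obtain ⟨Q, hQ⟩ := exists_map_mulVec_eq_of_span_le hf hg h.le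
  refine ⟨P, Q, eq_of_map_mulVec_eq hli ?_, hP, hQ⟩
  rw [Matrix.map_mul, ← mulVec_mulVec, ← hQ, ← hP, Matrix.map_one _ C_0 C_1, one_mulVec]

lemma linearIndependent_map_mulVec [DecidableEq ι] {P Q : Matrix ι ι k}
    (hg : LinearIndependent k g) (hPQ : P * Q = 1) : LinearIndependent k (Q.map C *ᵥ g) := by
  refine linearIndependent_iff_dotProduct.mpr fun c hc => ?_
  have hcQ : c ᵥ* Q = 0 := by
    refine linearIndependent_iff_dotProduct.mp hg _ ?_
    rw [dotProduct_mulVec] at hc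
    rw [← hc]
    congr 1
    ext1 j
    exact RingHom.map_vecMul C Q c j
  rw [← vecMul_one c, ← mul_eq_one_comm.mp hPQ, ← vecMul_vecMul, hcQ, zero_vecMul]

end Forms

section QuadricsRelations

open Matrix

lemma map_comp_quadrics {A B F : Type*} [CommRing A] [CommRing B] [FunLike F A B]
    [RingHomClass F A B] (f : F) (x : Fin 3 → A) : f ∘ quadrics x = quadrics (f ∘ x) := by
  ext i
  fin_cases i <;> simp [quadrics]

variable {k : Type*} [CommRing k]

lemma dotProduct_quadrics (c : Fin 5 → k) (x : Fin 3 → k) : c ⬝ᵥ quadrics x =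
    c 0 * (x 0 * x 1) + c 1 * (x 0 * x 2) + c 2 * (x 1 * x 2) + c 3 * (x 0 * x 0 - x 2 * x 2) +
      c 4 * (x 1 * x 1 - x 2 * x 2) := by
  rw [dotProduct, Fin.sum_univ_five]
  rfl

lemma eq_zero_of_dotProduct_quadrics_add_eq_zero {c : Fin 5 → k} {c' : k}
    (h : ∀ x : Fin 3 → k, c ⬝ᵥ quadrics x + c' * x 2 ^ 2 = 0) : c = 0 ∧ c' = 0 := by
  have key (x y z : k) := h ![x, y, z]
  simp only [dotProduct_quadrics, cons_val] at key
  have h3 : c 3 = 0 := by linear_combination key 1 0 0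
  have h4 : c 4 = 0 := by linear_combination key 0 1 0
  have h5 : c' = 0 := by linear_combination key 0 0 1 + h3 + h4
  have h0 : c 0 = 0 := by linear_combination key 1 1 0 - h3 - h4
  have h1 : c 1 = 0 := by linear_combination key 1 0 1 + h4 - h5
  have h2 : c 2 = 0 := by linear_combination key 0 1 1 + h3 - h5
  refine ⟨funext fun i => ?_, h5⟩
  fin_cases i <;> assumption

lemma eq_of_quadrics_dotProduct_mulVec_eq_zero (h2 : IsUnit (2 : k)) {S : Matrix (Fin 5) (Fin 3) k}
    (hS : ∀ x, quadrics x ⬝ᵥ S *ᵥ x = 0) :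
    S = !![-S 3 1, -S 4 0, -S 1 1 - S 2 0;
           -S 3 2, S 1 1, S 4 0;
           S 2 0, S 3 2, S 3 1;
           0, S 3 1, S 3 2;
           S 4 0, 0, -S 3 2] := by
  have key (x y z : k) := hS ![x, y, z]
  simp only [dotProduct_comm (quadrics _), dotProduct_quadrics, mulVec, vec3_dotProduct, cons_val]
    at key
  have half {a b : k} (h : a + b = 0) (h' : b - a = 0) : a = 0 ∧ b = 0 := by
    have hb : b = 0 := h2.mul_right_eq_zero.mp (by linear_combination h + h')
    exact ⟨by linear_combination h - hb, hb⟩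
  have e30 : S 3 0 = 0 := by linear_combination key 1 0 0
  have e41 : S 4 1 = 0 := by linear_combination key 0 1 0
  have e42 : S 4 2 + S 3 2 = 0 := by linear_combination -key 0 0 1
  obtain ⟨e00, e01⟩ : S 0 0 + S 3 1 = 0 ∧ S 0 1 + S 4 0 = 0 :=
    half (by linear_combination key 1 1 0 - e30 - e41)
      (by linear_combination key 1 (-1) 0 - e30 + e41)
  obtain ⟨e10, e12⟩ : S 1 0 + S 3 2 = 0 ∧ S 1 2 - S 4 0 = 0 :=
    half (by linear_combination key 1 0 1 + e42)
      (by linear_combination key 1 0 (-1) - e42)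
  obtain ⟨e21, e22⟩ : S 2 1 - S 3 2 = 0 ∧ S 2 2 - S 3 1 = 0 :=
    half (by linear_combination key 0 1 1)
      (by linear_combination key 0 1 (-1))
  have e02 : S 0 2 + S 1 1 + S 2 0 = 0 := by
    linear_combination key 1 1 1 - e00 - e01 - e10 - e12 - e21 - e22
  ext i j
  fin_cases i <;> fin_cases j <;>
    simp only [Fin.zero_eta, Fin.mk_one, Fin.reduceFinMk, of_apply, cons_val] <;> grind

lemma exists_vecMul_eq_vecMul_quadricsDual (h2 : IsUnit (2 : k)) {B : Type*} [CommRing B]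
    [Algebra k B] {S : Matrix (Fin 5) (Fin 3) k} (hS : ∀ x, quadrics x ⬝ᵥ S *ᵥ x = 0)
    (T : Fin 5 → B) : ∃ a : Fin 5 → k,
      T ᵥ* S.map (algebraMap k B) = (algebraMap k B ∘ a) ᵥ* quadricsDual T := by
  refine ⟨![S 2 0 + S 1 1, -S 1 1, -S 4 0, -S 3 1, -S 3 2], ?_⟩
  rw [eq_of_quadrics_dotProduct_mulVec_eq_zero h2 hS]
  ext j
  fin_cases j <;>
    simp [vecMul, dotProduct, Fin.sum_univ_five, quadricsDual] <;> ring

end QuadricsRelations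

section QuadricsOfForms

open Matrix

variable {k : Type*} [Field k] {m n : Matrix (Fin 3) (Fin 3) k}

lemma eval_comp_toMvPolynomial {σ ι : Type*} [Fintype σ] (N : Matrix ι σ k) (x : σ → k) :
    eval x ∘ N.toMvPolynomial = N *ᵥ x :=
  funext fun i => toMvPolynomial_eval_eq_apply N i x

lemma eval_dotProduct_quadrics (h : m * n = 1) (x : Fin 3 → k) (c : Fin 5 → k) :
    eval (n *ᵥ x) ((C ∘ c) ⬝ᵥ quadrics m.toMvPolynomial) = c ⬝ᵥ quadrics x := by
  have hc : eval (n *ᵥ x) ∘ C ∘ c = c := funext fun i => eval_C (c i)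
  rw [RingHom.map_dotProduct, hc, map_comp_quadrics, eval_comp_toMvPolynomial, mulVec_mulVec, h,
    one_mulVec]

lemma linearIndependent_quadrics (h : m * n = 1) :
    LinearIndependent k (quadrics m.toMvPolynomial) := by
  refine linearIndependent_iff_dotProduct.mpr fun c hc => ?_
  refine (eq_zero_of_dotProduct_quadrics_add_eq_zero (c' := 0) fun x => ?_).1
  rw [zero_mul, add_zero, ← eval_dotProduct_quadrics h]
  exact (congrArg _ hc).trans (map_zero _)

lemma isHomogeneous_quadrics {σ : Type*} {y : Fin 3 → MvPolynomial σ k}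
    (hy : ∀ i, (y i).IsHomogeneous 1) (i : Fin 5) : (quadrics y i).IsHomogeneous 2 := by
  have h (a b) : (y a * y b).IsHomogeneous 2 := (hy a).mul (hy b)
  fin_cases i
  exacts [h 0 1, h 0 2, h 1 2, (h 0 0).sub (h 2 2), (h 1 1).sub (h 2 2)]

lemma isUnit_two_mvPolynomial {σ : Type*} (h2 : (2 : k) ≠ 0) : IsUnit (2 : MvPolynomial σ k) := by
  simpa only [map_ofNat] using h2.isUnit.map (C : k →+* MvPolynomial σ k)

end QuadricsOfForms

section ChangeOfGenerators

open Matrix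

variable {k : Type*} [Field k] {m n : Matrix (Fin 3) (Fin 3) k}
  {P Q N : Matrix (Fin 5) (Fin 5) k} {φ : Matrix (Fin 5) (Fin 5) (MvPolynomial (Fin 3) k)}

variable (k) in
/-- The inclusion of the constants into `k[x, y, z][T]`. -/
abbrev constHom : k →+* MvPolynomial (Fin 5) (MvPolynomial (Fin 3) k) :=
  algebraMap k _

lemma C_comp_map_mulVec {ι κ : Type*} [Fintype κ] (M : Matrix ι κ k)
    (v : κ → MvPolynomial (Fin 3) k) :
    C ∘ (M.map C *ᵥ v) = M.map (constHom k) *ᵥ (C ∘ v) :=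
  funext fun i => RingHom.map_mulVec C (M.map C) v i

lemma exists_C_comp_dotProduct_eq (h2 : (2 : k) ≠ 0) (h : m * n = 1) (hPQ : P * Q = 1)
    {v : Fin 5 → MvPolynomial (Fin 3) k} (hv : ∀ i, (v i).IsHomogeneous 1)
    (hfv : (Q.map C *ᵥ quadrics m.toMvPolynomial) ⬝ᵥ v = 0) :
    ∃ a : Fin 5 → k, X ⬝ᵥ (C ∘ v) = (constHom k ∘ a) ⬝ᵥ
      quadricsDual (P.map (constHom k) *ᵥ X) *ᵥ (C ∘ m.toMvPolynomial) := by
  obtain ⟨N, hN⟩ := exists_toMvPolynomial_eq hv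
  let c := N * n
  have hc : c.map C *ᵥ m.toMvPolynomial = v := by
    rw [Matrix.map_mul, ← mulVec_mulVec, map_mulVec_toMvPolynomial h,
      ← toMvPolynomial_eq_map_mulVec_X, hN]
  have hS (x : Fin 3 → k) : quadrics x ⬝ᵥ (Qᵀ * c) *ᵥ x = 0 := by
    have hx := congrArg (eval (n *ᵥ x)) hfv
    have heval {l : ℕ} (L : Matrix (Fin 5) (Fin l) k) (w : Fin l → MvPolynomial (Fin 3) k) :
        eval (n *ᵥ x) ∘ (L.map C *ᵥ w) = L *ᵥ (eval (n *ᵥ x) ∘ w) := by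
      ext1 i
      rw [Function.comp_apply, RingHom.map_mulVec]
      congr 2
      ext1 i j
      exact eval_C (L i j)
    rw [RingHom.map_dotProduct, ← hc, heval, heval, map_comp_quadrics, eval_comp_toMvPolynomial,
      mulVec_mulVec, h, one_mulVec, map_zero] at hx
    rw [← mulVec_mulVec, dotProduct_mulVec, vecMul_transpose, hx]
  obtain ⟨a, ha⟩ := exists_vecMul_eq_vecMul_quadricsDual h2.isUnit hS (P.map (constHom k) *ᵥ X)
  refine ⟨a, ?_⟩
  have hX : (P.map (constHom k) *ᵥ X) ᵥ* Qᵀ.map (constHom k) = X := by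
    rw [transpose_map, vecMul_transpose, mulVec_mulVec, ← Matrix.map_mul, mul_eq_one_comm.mp hPQ,
      Matrix.map_one _ (map_zero _) (map_one _), one_mulVec]
  rw [dotProduct_mulVec, ← ha, Matrix.map_mul, ← vecMul_vecMul, hX, ← dotProduct_mulVec,
    ← C_comp_map_mulVec, hc]

lemma exists_TMul_eq_quadricsDual_mulVec (h2 : (2 : k) ≠ 0) (h : m * n = 1) (hPQ : P * Q = 1)
    (hφ : ∀ i j, (φ i j).IsHomogeneous 1)
    (hfφ : (Q.map C *ᵥ quadrics m.toMvPolynomial) ᵥ* φ = 0) :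
    ∃ N : Matrix (Fin 5) (Fin 5) k, TMul φ = N.map (constHom k) *ᵥ
      quadricsDual (P.map (constHom k) *ᵥ X) *ᵥ (C ∘ m.toMvPolynomial) := by
  choose a ha using fun j =>
    exists_C_comp_dotProduct_eq h2 h hPQ (fun i => hφ i j) (congrFun hfφ j)
  exact ⟨of a, funext ha⟩

lemma eq_zero_of_X_dotProduct_eq_zero {A ι : Type*} [CommRing A] [Fintype ι] {v : ι → A}
    (h : X ⬝ᵥ (C ∘ v : ι → MvPolynomial ι A) = 0) : v = 0 := by
  classical
  ext i
  have hi := congrArg (eval (Pi.single i (1 : A))) h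
  simpa [dotProduct, Pi.single_apply] using hi

lemma det_ne_zero_of_TMul_eq (h2 : (2 : k) ≠ 0) (hφ : φ.transpose = -φ)
    (hf : LinearIndependent k (pfaffians φ))
    {v : Fin 5 → MvPolynomial (Fin 5) (MvPolynomial (Fin 3) k)}
    (hN : TMul φ = N.map (constHom k) *ᵥ v) : N.det ≠ 0 := by
  intro hdet
  obtain ⟨c, hc, hcN⟩ := exists_vecMul_eq_zero_iff.mpr hdet
  refine hc (eq_zero_of_mulVec_algebraMap_eq_zero hφ
    (apply_self_eq_zero_of_transpose_eq_neg (isUnit_two_mvPolynomial h2) hφ) hf ?_)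
  refine eq_zero_of_X_dotProduct_eq_zero ?_
  have hcT : TMul φ ⬝ᵥ (constHom k ∘ c) = 0 := by
    have hcN' : (constHom k ∘ c) ᵥ* N.map (constHom k) = 0 := funext fun j => by
      rw [← RingHom.map_vecMul, hcN, Pi.zero_apply, Pi.zero_apply, map_zero]
    rw [hN, dotProduct_comm, dotProduct_mulVec, hcN', zero_dotProduct]
  rw [TMul_eq_vecMul, ← dotProduct_mulVec] at hcT
  rw [← hcT]
  congr 1
  ext1 i
  exact RingHom.map_mulVec C φ _ i

lemma jacobianDual_eq_mul_quadricsDual_mul (hN : TMul φ = N.map (constHom k) *ᵥ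
      quadricsDual (P.map (constHom k) *ᵥ X) *ᵥ (C ∘ m.toMvPolynomial)) :
    jacobianDual φ = N.map (constHom k) * quadricsDual (P.map (constHom k) *ᵥ X) *
      m.map (constHom k) := by
  let c : k →+* MvPolynomial (Fin 5) k := C
  let M := N.map c * quadricsDual (P.map c *ᵥ X) * m.map c
  have hmap {a b : ℕ} (L : Matrix (Fin a) (Fin b) k) :
      (L.map c).map (map C) = L.map (constHom k) := by
    ext1 i j
    exact map_C C (L i j)
  have hX : MvPolynomial.map (C : k →+* MvPolynomial (Fin 3) k) ∘ X =
      (X : Fin 5 → MvPolynomial (Fin 5) (MvPolynomial (Fin 3) k)) := by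
    ext1 j
    exact map_X C j
  have hPX : MvPolynomial.map (C : k →+* MvPolynomial (Fin 3) k) ∘ (P.map c *ᵥ X) =
      P.map (constHom k) *ᵥ X := by
    ext1 i
    rw [Function.comp_apply, RingHom.map_mulVec, hmap, hX]
  have hM : M.map (map C) = N.map (constHom k) * quadricsDual (P.map (constHom k) *ᵥ X) *
      m.map (constHom k) := by
    rw [Matrix.map_mul, Matrix.map_mul, hmap, hmap, map_quadricsDual, hPX]
  rw [← hM]
  refine jacobianDual_eq_of_TMul_eq ?_
  rw [hM, hN, toMvPolynomial_eq_map_mulVec_X, C_comp_map_mulVec, mulVec_mulVec, mulVec_mulVec]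

end ChangeOfGenerators

section DualIdeal

open Matrix

variable {k : Type*} [Field k] {m n : Matrix (Fin 3) (Fin 3) k}
  {P Q N : Matrix (Fin 5) (Fin 5) k} {φ : Matrix (Fin 5) (Fin 5) (MvPolynomial (Fin 3) k)}

lemma aeval_mem_of_quadricsDual {B : Type*} [CommRing B] [Algebra k B] {D : Ideal B}
    {x : Fin 3 → B} {T : Fin 5 → B} (hx : ∀ j, (quadricsDual T *ᵥ x) j ∈ D)
    (hT : minorsIdeal 3 (quadricsDual T) ≤ D) {g : MvPolynomial (Fin 3 ⊕ Fin 5) k}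
    (hg : aeval (reesGens k) g = 0) : aeval (Sum.elim x T) g ∈ D := by
  let π := Ideal.Quotient.mkₐ k D
  have hx' : quadricsDual (π ∘ T) *ᵥ (π ∘ x) = 0 := by
    ext1 j
    rw [← map_quadricsDual]
    refine (RingHom.map_mulVec π.toRingHom _ x j).symm.trans ?_
    exact Ideal.Quotient.eq_zero_iff_mem.mpr (hx j)
  have hT' : minorsIdeal 3 (quadricsDual (π ∘ T)) = ⊥ := by
    rw [← map_quadricsDual]
    refine (map_minorsIdeal π.toRingHom 3 (quadricsDual T)).symm.trans ?_
    rw [eq_bot_iff, Ideal.map_le_iff_le_comap]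
    exact fun d hd => Ideal.Quotient.eq_zero_iff_mem.mpr (hT hd)
  have h := aeval_eq_zero_of_quadricsDual hx' hT' hg
  rw [← Sum.comp_elim] at h
  replace h := (DFunLike.congr_fun (comp_aeval (Sum.elim x T) π) g).trans h
  exact Ideal.Quotient.eq_zero_iff_mem.mp h

lemma aeval_monomial_map_mulVec_X (P : Matrix (Fin 5) (Fin 5) k)
    (f : Fin 5 → MvPolynomial (Fin 3) k) (j : Fin 5) :
    aeval (fun i => Polynomial.monomial 1 (f i)) ((P.map (constHom k) *ᵥ X) j) =
      Polynomial.monomial 1 ((P.map C *ᵥ f) j) := by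
  simp only [mulVec, dotProduct, map_apply, map_sum, map_mul, aeval_X]
  refine Finset.sum_congr rfl fun i _ => ?_
  rw [← Polynomial.C_mul_monomial]
  congr 1
  exact algHom_C _ (C (P j i))

lemma aeval_reesGens_eq_zero (h : m * n = 1) (hPQ : P * Q = 1)
    {g : MvPolynomial (Fin 3 ⊕ Fin 5) k}
    (hg : aeval (Sum.elim (C ∘ m.toMvPolynomial) (P.map (constHom k) *ᵥ X)) g ∈
      reesIdeal (Q.map C *ᵥ quadrics m.toMvPolynomial)) : aeval (reesGens k) g = 0 := by
  let f := Q.map C *ᵥ quadrics m.toMvPolynomial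
  let π : MvPolynomial (Fin 5) (MvPolynomial (Fin 3) k) →ₐ[MvPolynomial (Fin 3) k]
    Polynomial (MvPolynomial (Fin 3) k) := aeval fun i => Polynomial.monomial 1 (f i)
  have hPf : P.map C *ᵥ f = quadrics m.toMvPolynomial := by
    rw [mulVec_mulVec, ← Matrix.map_mul, hPQ, Matrix.map_one _ C_0 C_1, one_mulVec]
  have hcomp : (π.restrictScalars k).comp
      (aeval (Sum.elim (C ∘ m.toMvPolynomial) (P.map (constHom k) *ᵥ X))) =
      (Polynomial.mapAlgHom (aeval m.toMvPolynomial)).comp (aeval (reesGens k)) := by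
    ext1 (i | j)
    · simp [π, reesGens]
    · have hy := congrFun (map_comp_quadrics (aeval (R := k) m.toMvPolynomial) X) j
      rw [aeval_comp_X] at hy
      rw [AlgHom.comp_apply, AlgHom.comp_apply, aeval_X, aeval_X]
      refine Eq.trans ?_ (Polynomial.map_monomial _).symm
      exact (aeval_monomial_map_mulVec_X P f j).trans (congrArg _ ((congrFun hPf j).trans hy.symm))
  refine Polynomial.map_injective (aeval m.toMvPolynomial).toRingHom
    ((aeval_toMvPolynomial_leftInverse h).injective) ?_
  rw [Polynomial.map_zero]
  exact (DFunLike.congr_fun hcomp g).symm.trans hg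

lemma subalgebra_eq_top_of_forall_mem {R σ τ : Type*} [CommSemiring R]
    {S : Subalgebra R (MvPolynomial σ (MvPolynomial τ R))} (hC : ∀ j, C (X j) ∈ S)
    (hX : ∀ i, X i ∈ S) : S = ⊤ := by
  refine eq_top_iff.mpr fun p _ => ?_
  induction p using MvPolynomial.induction_on with
  | C q =>
    induction q using MvPolynomial.induction_on with
    | C a => exact S.algebraMap_mem a
    | add p q hp hq => rw [C_add]; exact S.add_mem (hp trivial) (hq trivial)
    | mul_X p j hp => rw [C_mul]; exact S.mul_mem (hp trivial) (hC j)
  | add p q hp hq => exact S.add_mem (hp trivial) (hq trivial)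
  | mul_X p i hp => exact S.mul_mem (hp trivial) (hX i)

lemma map_constHom_mulVec_mem {ι κ : Type*} [Fintype κ] (M : Matrix ι κ k)
    {S : Subalgebra k (MvPolynomial (Fin 5) (MvPolynomial (Fin 3) k))}
    {v : κ → MvPolynomial (Fin 5) (MvPolynomial (Fin 3) k)} (hv : ∀ j, v j ∈ S) (i : ι) :
    (M.map (constHom k) *ᵥ v) i ∈ S :=
  S.sum_mem fun j _ => S.mul_mem (S.algebraMap_mem (M i j)) (hv j)

lemma map_constHom_mulVec_map_mulVec (hPQ : P * Q = 1)
    (v : Fin 5 → MvPolynomial (Fin 5) (MvPolynomial (Fin 3) k)) :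
    P.map (constHom k) *ᵥ Q.map (constHom k) *ᵥ v = v := by
  rw [mulVec_mulVec, ← Matrix.map_mul, hPQ, Matrix.map_one _ (map_zero _) (map_one _), one_mulVec]

lemma aeval_coordinates_surjective (h : m * n = 1) (hQP : Q * P = 1) :
    Function.Surjective
      (aeval (R := k) (Sum.elim (C ∘ m.toMvPolynomial) (P.map (constHom k) *ᵥ X))) := by
  let v : Fin 3 ⊕ Fin 5 → MvPolynomial (Fin 5) (MvPolynomial (Fin 3) k) :=
    Sum.elim (C ∘ m.toMvPolynomial) (P.map (constHom k) *ᵥ X)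
  have hv (l) : v l ∈ (aeval (R := k) v).range := ⟨X l, aeval_X v l⟩
  have hn : n.map (constHom k) *ᵥ (v ∘ Sum.inl) = C ∘ X := by
    rw [← map_mulVec_toMvPolynomial h, C_comp_map_mulVec]; rfl
  have hQ : Q.map (constHom k) *ᵥ (v ∘ Sum.inr) = X :=
    map_constHom_mulVec_map_mulVec hQP X
  rw [← AlgHom.range_eq_top]
  refine subalgebra_eq_top_of_forall_mem (fun j => ?_) fun i => ?_
  · rw [show C (X j) = _ from (congrFun hn j).symm]
    exact map_constHom_mulVec_mem n (fun i => hv (Sum.inl i)) j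
  · exact congrFun hQ i ▸ map_constHom_mulVec_mem Q (fun i => hv (Sum.inr i)) i

lemma quadricsDual_mulVec_mem_dualIdeal {N' : Matrix (Fin 5) (Fin 5) k} (hN' : N' * N = 1)
    {v : Fin 5 → MvPolynomial (Fin 5) (MvPolynomial (Fin 3) k)}
    (hN : TMul φ = N.map (constHom k) *ᵥ v) (j : Fin 5) : v j ∈ dualIdeal φ := by
  rw [← map_constHom_mulVec_map_mulVec hN' v, ← hN]
  have hT (l) : TMul φ l ∈ dualIdeal φ := Ideal.mem_sup_left (Ideal.subset_span ⟨l, rfl⟩)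
  exact (dualIdeal φ).sum_mem (t := Finset.univ) fun l _ => Ideal.mul_mem_left _ _ (hT l)

lemma minorsIdeal_quadricsDual_le_dualIdeal (h : m * n = 1)
    {N' : Matrix (Fin 5) (Fin 5) k} (hN' : N' * N = 1)
    {M : Matrix (Fin 5) (Fin 3) (MvPolynomial (Fin 5) (MvPolynomial (Fin 3) k))}
    (hN : jacobianDual φ = N.map (constHom k) * M * m.map (constHom k)) :
    minorsIdeal 3 M ≤ dualIdeal φ := by
  have hmap {l : ℕ} {L L' : Matrix (Fin l) (Fin l) k} (hL : L * L' = 1) :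
      L.map (constHom k) * L'.map (constHom k) = 1 := by
    rw [← Matrix.map_mul, hL, Matrix.map_one _ (map_zero _) (map_one _)]
  have hM : M = N'.map (constHom k) * (jacobianDual φ * n.map (constHom k)) := by
    rw [hN, Matrix.mul_assoc, Matrix.mul_assoc, hmap h, Matrix.mul_one, ← Matrix.mul_assoc,
      hmap hN', Matrix.one_mul]
  rw [hM]
  exact (minorsIdeal_mul_left_le 3 _ _).trans ((minorsIdeal_mul_right_le 3 _ _).trans le_sup_right)

theorem dualIdeal_eq_reesIdeal (h2 : (2 : k) ≠ 0) (h : m * n = 1)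
    (hφ : IsPfaffianMatrix φ (Ideal.span (Set.range (quadrics m.toMvPolynomial)))) :
    dualIdeal φ = reesIdeal (pfaffians φ) := by
  have hfφ : pfaffians φ ᵥ* φ = 0 := pfaffians_vecMul hφ.skew
    (apply_self_eq_zero_of_transpose_eq_neg (isUnit_two_mvPolynomial h2) hφ.skew)
  refine le_antisymm (dualIdeal_le_reesIdeal hφ.linear hfφ) fun g hg => ?_
  obtain ⟨P, Q, hPQ, -, hQ⟩ := exists_inverse_matrices_of_span_eq
    (isHomogeneous_pfaffians hφ.linear) (isHomogeneous_quadrics m.toMvPolynomial_isHomogeneous)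
    hφ.span_eq (linearIndependent_quadrics h)
  have hf : LinearIndependent k (pfaffians φ) :=
    hQ ▸ linearIndependent_map_mulVec (linearIndependent_quadrics h) hPQ
  obtain ⟨N, hN⟩ := exists_TMul_eq_quadricsDual_mulVec h2 h hPQ hφ.linear (hQ ▸ hfφ)
  have hN' : N⁻¹ * N = 1 :=
    nonsing_inv_mul N (det_ne_zero_of_TMul_eq h2 hφ.skew hf hN).isUnit
  obtain ⟨g, rfl⟩ := aeval_coordinates_surjective h (mul_eq_one_comm.mp hPQ) g
  refine aeval_mem_of_quadricsDual (quadricsDual_mulVec_mem_dualIdeal hN' hN)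
    (minorsIdeal_quadricsDual_le_dualIdeal h hN' (jacobianDual_eq_mul_quadricsDual_mul hN)) ?_
  exact aeval_reesGens_eq_zero h hPQ (hQ ▸ hg)

end DualIdeal

section QuadricsMatrix

/-- A skew-symmetric matrix of linear forms in `x` whose Pfaffians are the five quadrics
`quadrics x`. -/
def quadricsMatrix {A : Type*} [CommRing A] (x : Fin 3 → A) : Matrix (Fin 5) (Fin 5) A :=
  !![0, x 0, -x 1, -x 2, x 2;
     -x 0, 0, x 2, x 1, 0;
     x 1, -x 2, 0, 0, -x 0;
     x 2, -x 1, 0, 0, 0;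
     -x 2, 0, x 0, 0, 0]

lemma pfaffians_quadricsMatrix {A : Type*} [CommRing A] (x : Fin 3 → A) :
    pfaffians (quadricsMatrix x) = quadrics x := by
  rw [pfaffians_eq]
  ext1 i
  fin_cases i <;> simp [quadricsMatrix, quadrics] <;> ring

lemma isPfaffianMatrix_quadricsMatrix {k : Type*} [Field k] {l : ℕ}
    {y : Fin 3 → MvPolynomial (Fin l) k} (hy : ∀ i, (y i).IsHomogeneous 1) :
    IsPfaffianMatrix (quadricsMatrix y) (Ideal.span (Set.range (quadrics y))) where
  skew := by
    ext1 i j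
    fin_cases i <;> fin_cases j <;> simp [quadricsMatrix]
  linear i j := by
    have h0 := isHomogeneous_zero (R := k) (Fin l) 1
    fin_cases i <;> fin_cases j
    all_goals first | exact h0 | exact hy _ | exact (hy _).neg
  span_eq := by rw [pfaffians_quadricsMatrix]

end QuadricsMatrix

section Depth

open RingTheory.Sequence

variable {A : Type*} [CommRing A] {𝔞 : Ideal A}

lemma not_isRegular_cons_cons {B : Type*} [CommRing B] [IsDomain B] [Algebra A B]
    (hAB : Function.Injective (algebraMap A B)) {β : B} (hβ : β ∉ Set.range (algebraMap A B))
    {a b : A} (ha : algebraMap A B a * β ∈ Set.range (algebraMap A B))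
    (hb : algebraMap A B b * β ∈ Set.range (algebraMap A B)) (l : List A) :
    ¬ IsRegular A (a :: b :: l) := by
  intro h
  obtain ⟨hreg_a, hbl⟩ := (isRegular_cons_iff A a (b :: l)).mp h
  obtain ⟨hreg_b, -⟩ := (isRegular_cons_iff _ b l).mp hbl
  have := h.nontrivial
  have ha0 : a ≠ 0 := fun h0 => (h0 ▸ hreg_a).not_zero
  obtain ⟨a', ha'⟩ := ha
  obtain ⟨b', hb'⟩ := hb
  have hab : b * a' = a * b' := hAB <| by rw [map_mul, map_mul, ha', hb']; ring
  have hba : b • (Submodule.Quotient.mk a' : QuotSMulTop a A) = 0 := by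
    rw [← Submodule.Quotient.mk_smul, Submodule.Quotient.mk_eq_zero, smul_eq_mul, hab]
    exact Submodule.smul_mem_pointwise_smul b' a ⊤ trivial
  obtain ⟨d, -, hd : a * d = a'⟩ :=
    (Submodule.Quotient.mk_eq_zero _).mp (hreg_b.right_eq_zero_of_smul hba)
  refine hβ ⟨d, mul_left_cancel₀ ((map_ne_zero_iff _ hAB).mpr ha0) ?_⟩
  rw [← ha', ← hd, map_mul]

lemma depthAlong_le_one {B : Type*} [CommRing B] [IsDomain B] [Algebra A B]
    (hAB : Function.Injective (algebraMap A B)) {β : B} (hβ : β ∉ Set.range (algebraMap A B))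
    (h𝔞 : ∀ a ∈ 𝔞, algebraMap A B a * β ∈ Set.range (algebraMap A B)) : depthAlong 𝔞 ≤ 1 := by
  refine iSup_le fun rs => iSup_le fun hreg => iSup_le fun hmem => ?_
  match rs, hreg, hmem with
  | [], _, _ => exact zero_le_one
  | [_], _, _ => exact le_rfl
  | a :: b :: l, hreg, hmem =>
    exact (not_isRegular_cons_cons hAB hβ (h𝔞 a (hmem a (by simp))) (h𝔞 b (hmem b (by simp))) l
      hreg).elim

lemma one_le_depthAlong [IsDomain A] (h𝔞 : 𝔞 ≠ ⊤) {a : A} (ha : a ∈ 𝔞) (ha0 : a ≠ 0) :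
    1 ≤ depthAlong 𝔞 := by
  have hspan : Ideal.ofList [a] ≤ 𝔞 := by
    rwa [Ideal.ofList_singleton, Ideal.span_singleton_le_iff_mem]
  have hreg : IsRegular A [a] := by
    refine ⟨(isWeaklyRegular_singleton_iff A a).mpr (IsSMulRegular.of_ne_zero ha0), fun h => ?_⟩
    rw [smul_eq_mul, Ideal.mul_top] at h
    exact h𝔞 (top_le_iff.mp (h.le.trans hspan))
  exact le_iSup_of_le [a] (le_iSup_of_le hreg (le_iSup_of_le (by simpa using ha) le_rfl))

lemma mul_mem_pow_succ {I : Ideal A} {w : A} (hI : ∀ f ∈ I, f * w ∈ I ^ 2) {i : ℕ} {f : A}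
    (hf : f ∈ I ^ (i + 1)) : f * w ∈ I ^ (i + 2) := by
  have h : I ^ i * I ≤ Submodule.comap (LinearMap.mulRight A w) (I ^ (i + 2)) := by
    refine Ideal.mul_le.mpr fun r hr s hs => ?_
    rw [Submodule.mem_comap, LinearMap.mulRight_apply, mul_assoc, pow_add]
    exact Ideal.mul_mem_mul hr (hI s hs)
  exact h (pow_succ I i ▸ hf)

lemma mul_mem_of_constantCoeff_eq_zero {σ : Type*} {I : Ideal (MvPolynomial σ A)}
    {w : MvPolynomial σ A} (hX : ∀ l, X l * w ∈ I) {p : MvPolynomial σ A}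
    (hp : constantCoeff p = 0) : p * w ∈ I := by
  have h : idealOfVars σ A ≤ Submodule.comap (LinearMap.mulRight _ w) I :=
    Ideal.span_le.mpr <| by rintro _ ⟨l, rfl⟩; exact hX l
  exact h (mem_idealOfVars_of_constantCoeff_eq_zero hp)

variable {k : Type*} [Field k] {n : ℕ} {I : Ideal (MvPolynomial (Fin n) k)}
  {w : MvPolynomial (Fin n) k}

lemma mul_monomial_mem_reesAlgebra (hX : ∀ l, X l * w ∈ I) (hI : ∀ f ∈ I, f * w ∈ I ^ 2)
    {a : reesAlgebra I} (ha : a ∈ reesMaximalIdeal I) :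
    (a : Polynomial (MvPolynomial (Fin n) k)) * Polynomial.monomial 1 w ∈ reesAlgebra I := by
  intro i
  rcases i with _ | _ | i
  · rw [pow_zero, Ideal.one_eq_top]
    exact Submodule.mem_top
  · rw [zero_add, pow_one, ← zero_add 1, Polynomial.coeff_mul_monomial]
    exact mul_mem_of_constantCoeff_eq_zero hX ha
  · rw [Polynomial.coeff_mul_monomial]
    exact mul_mem_pow_succ hI (a.2 (i + 1))

theorem depthAlong_reesMaximalIdeal_eq_one [NeZero n] (hw : w ∉ I) (hX : ∀ l, X l * w ∈ I)
    (hI : ∀ f ∈ I, f * w ∈ I ^ 2) : depthAlong (reesMaximalIdeal I) = 1 := by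
  refine le_antisymm (depthAlong_le_one (B := Polynomial (MvPolynomial (Fin n) k))
    (β := Polynomial.monomial 1 w) Subtype.val_injective ?_ fun a ha => ?_) ?_
  · rintro ⟨a, ha : a.1 = _⟩
    have hmem : Polynomial.monomial 1 w ∈ reesAlgebra I := ha ▸ a.2
    rw [reesAlgebra.monomial_mem, pow_one] at hmem
    exact hw hmem
  · exact ⟨⟨_, mul_monomial_mem_reesAlgebra hX hI ha⟩, rfl⟩
  · refine one_le_depthAlong (RingHom.ker_ne_top _)
      (a := algebraMap (MvPolynomial (Fin n) k) (reesAlgebra I) (X 0)) ?_ ?_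
    · change constantCoeff ((Polynomial.C (X 0 : MvPolynomial (Fin n) k)).coeff 0) = 0
      rw [Polynomial.coeff_C_zero, constantCoeff_X]
    · intro h
      exact X_ne_zero 0 (Polynomial.C_eq_zero.mp (congrArg Subtype.val h))

end Depth

section Jacobian

open Matrix

variable {k : Type*} [Field k] {n a b : ℕ}

lemma jacobianIdeal_le (r : ℕ) {g : Fin a → MvPolynomial (Fin n) k}
    {g' : Fin b → MvPolynomial (Fin n) k}
    (h : Ideal.span (Set.range g) ≤ Ideal.span (Set.range g')) :
    jacobianIdeal r g ≤ jacobianIdeal r g' := by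
  choose H hH using fun i =>
    Ideal.mem_span_range_iff_exists_fun.mp (h (Ideal.subset_span (Set.mem_range_self i)))
  let q := Ideal.Quotient.mk (Ideal.span (Set.range g'))
  have hq (j) : q (g' j) = 0 :=
    Ideal.Quotient.eq_zero_iff_mem.mpr (Ideal.subset_span (Set.mem_range_self j))
  -- Modulo `g'` the coefficients `H` behave like constants.
  have hder : (jacobianMatrix g).map q = (of H * jacobianMatrix g').map q := by
    ext1 i l
    simp only [jacobianMatrix, map_apply, of_apply, mul_apply, ← hH i, map_sum, Derivation.leibniz,
      smul_eq_mul, map_add, map_mul, hq, zero_mul, add_zero]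
  have hminors : (minorsIdeal r (jacobianMatrix g)).map q ≤
      (minorsIdeal r (jacobianMatrix g')).map q := by
    rw [map_minorsIdeal, hder, ← map_minorsIdeal]
    exact Ideal.map_mono (minorsIdeal_mul_left_le r _ _)
  refine sup_le (h.trans le_sup_left) ((Ideal.map_le_iff_le_comap.mp hminors).trans ?_)
  rw [Ideal.comap_map_of_surjective q Ideal.Quotient.mk_surjective, ← RingHom.ker_eq_comap_bot,
    Ideal.mk_ker, sup_comm]
  rfl

lemma jacobianIdeal_congr (r : ℕ) {g : Fin a → MvPolynomial (Fin n) k}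
    {g' : Fin b → MvPolynomial (Fin n) k}
    (h : Ideal.span (Set.range g) = Ideal.span (Set.range g')) :
    jacobianIdeal r g = jacobianIdeal r g' :=
  le_antisymm (jacobianIdeal_le r h.le) (jacobianIdeal_le r h.ge)

/-- Generators of the pencil of conics through the points `(±1, ±1, 1)`. -/
def conics {A : Type*} [CommRing A] (x : Fin 3 → A) : Fin 2 → A :=
  ![x 0 * x 0 - x 2 * x 2, x 1 * x 1 - x 2 * x 2]

/-- Half the Jacobian matrix of the two conics `conics x` with respect to `x`. -/
def halfJacobianConics {A : Type*} [CommRing A] (x : Fin 3 → A) : Matrix (Fin 2) (Fin 3) A :=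
  !![x 0, 0, -x 2; 0, x 1, -x 2]

lemma span_conics_sup_minorsIdeal {A : Type*} [CommRing A] (x : Fin 3 → A) :
    Ideal.span (Set.range (conics x)) ⊔ minorsIdeal 2 (halfJacobianConics x) =
      Ideal.span (Set.range (quadrics x)) := by
  apply le_antisymm
  · have hq (i) : quadrics x i ∈ Ideal.span (Set.range (quadrics x)) :=
      Ideal.subset_span (Set.mem_range_self i)
    refine sup_le (Ideal.span_le.mpr ?_) (Ideal.span_le.mpr ?_)
    · rintro _ ⟨i, rfl⟩
      fin_cases i
      exacts [hq 3, hq 4]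
    · rintro _ ⟨r, c, rfl⟩
      have h01 : x 0 * x 1 ∈ Ideal.span (Set.range (quadrics x)) := hq 0
      have h02 : x 0 * x 2 ∈ Ideal.span (Set.range (quadrics x)) := hq 1
      have h12 : x 1 * x 2 ∈ Ideal.span (Set.range (quadrics x)) := hq 2
      rw [SetLike.mem_coe, det_fin_two]
      simp only [submatrix_apply]
      generalize r 0 = r0, r 1 = r1, c 0 = c0, c 1 = c1
      fin_cases r0 <;> fin_cases r1 <;> fin_cases c0 <;> fin_cases c1 <;>
        simp [halfJacobianConics, h01, h02, h12, mul_comm (x 1) (x 0), mul_comm (x 2)]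
  · set K := Ideal.span (Set.range (conics x)) ⊔ minorsIdeal 2 (halfJacobianConics x)
    have hc (j) : conics x j ∈ K :=
      Ideal.mem_sup_left (Ideal.subset_span (Set.mem_range_self j))
    have hm (s) : ((halfJacobianConics x).submatrix id s).det ∈ K :=
      Ideal.mem_sup_right (det_submatrix_mem_minorsIdeal _ id s)
    simp only [det_fin_two, halfJacobianConics, submatrix_apply, id_eq, of_apply, cons_val] at hm
    refine Ideal.span_le.mpr ?_
    rintro _ ⟨i, rfl⟩
    fin_cases i
    · simpa [quadrics] using hm ![0, 1]
    · simpa [quadrics] using hm ![0, 2]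
    · simpa [quadrics, mul_comm] using hm ![1, 2]
    exacts [hc 0, hc 1]

lemma jacobianMatrix_conics_toMvPolynomial (m : Matrix (Fin 3) (Fin n) k) :
    jacobianMatrix (conics m.toMvPolynomial) =
      halfJacobianConics m.toMvPolynomial *
        ((2 : k) • m).map (C : k →+* MvPolynomial (Fin n) k) := by
  have hder (i l) : pderiv l (m.toMvPolynomial i) = C (m i l) := by
    rw [toMvPolynomial_eq_map_mulVec_X]
    exact pderiv_sum_C_mul_X (m i) l
  have htwo : (C 2 : MvPolynomial (Fin n) k) = 2 := map_ofNat C 2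
  refine Matrix.ext fun i l => ?_
  rw [mul_apply, Fin.sum_univ_three]
  fin_cases i <;> simp [jacobianMatrix, conics, halfJacobianConics, hder, htwo] <;> ring

lemma jacobianIdeal_conics (h2 : (2 : k) ≠ 0) {m n : Matrix (Fin 3) (Fin 3) k} (h : m * n = 1) :
    jacobianIdeal 2 (conics m.toMvPolynomial) =
      Ideal.span (Set.range (quadrics m.toMvPolynomial)) := by
  have hinv :
      ((2 : k) • m).map (C : k →+* MvPolynomial (Fin 3) k) * ((2 : k)⁻¹ • n).map C = 1 := by
    rw [← Matrix.map_mul, smul_mul_smul_comm, mul_inv_cancel₀ h2, h, one_smul,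
      Matrix.map_one _ C_0 C_1]
  rw [← span_conics_sup_minorsIdeal, jacobianIdeal, jacobianMatrix_conics_toMvPolynomial]
  refine congrArg _ (le_antisymm (minorsIdeal_mul_right_le 2 _ _) ?_)
  conv_lhs => rw [← Matrix.mul_one (halfJacobianConics m.toMvPolynomial), ← hinv]
  rw [← Matrix.mul_assoc]
  exact minorsIdeal_mul_right_le 2 _ _

end Jacobian

section ProjectiveFrame

open Matrix

variable {k : Type*} [Field k] {n : ℕ}

lemma det_rep_ne_zero {s : ℕ} {p : Fin s → ℙ k (Fin (n + 1) → k)}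
    (hp : InGeneralLinearPosition p) {e : Fin (n + 1) → Fin s} (he : Function.Injective e) :
    (of fun i => (p (e i)).rep).det ≠ 0 :=
  ((isUnit_iff_isUnit_det _).mp (linearIndependent_rows_iff_isUnit.mp
    (Projectivization.independent_iff.mp (hp ⟨e, he⟩)))).ne_zero

/-- The standard frame of `ℙⁿ`: the unit point `(1, …, 1)` and the `n + 1` coordinate points. -/
def standardFrame (k : Type*) [Field k] (n : ℕ) : Fin (n + 2) → Fin (n + 1) → k :=
  Fin.cons 1 fun i => Pi.single i 1

lemma exists_mulVec_standardFrame_eq {p : Fin (n + 2) → ℙ k (Fin (n + 1) → k)}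
    (hp : InGeneralLinearPosition p) :
    ∃ (V : Matrix (Fin (n + 1)) (Fin (n + 1)) k) (c : Fin (n + 2) → k), IsUnit V.det ∧
      (∀ i, c i ≠ 0) ∧ ∀ i, V *ᵥ standardFrame k n i = c i • (p i).rep := by
  let R : Matrix (Fin (n + 1)) (Fin (n + 1)) k := of fun i => (p i.succ).rep
  have hR : R.det ≠ 0 := det_rep_ne_zero hp (Fin.succ_injective _)
  -- By Cramer's rule, these are the coordinates of a multiple of `p 0` in the basis `p 1, …`.
  let α := cramer Rᵀ (p 0).rep
  have hα (i) : α i ≠ 0 := by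
    have hrows : R.updateRow i (p 0).rep =
        of fun j => (p (Equiv.swap 0 i.succ j.succ)).rep := by
      refine funext fun j => ?_
      rcases eq_or_ne j i with rfl | hj
      · exact updateRow_self.trans
          (congrArg (fun j => (p j).rep) (Equiv.swap_apply_right _ _).symm)
      · refine (updateRow_ne hj).trans ?_
        have hswap := Equiv.swap_apply_of_ne_of_ne j.succ_ne_zero ((Fin.succ_injective _).ne hj)
        exact congrArg (fun j => (p j).rep) hswap.symm
    change cramer Rᵀ (p 0).rep i ≠ 0
    rw [cramer_transpose_apply, hrows]
    exact det_rep_ne_zero hp ((Equiv.swap 0 i.succ).injective.comp (Fin.succ_injective _))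
  refine ⟨Rᵀ * diagonal α, Fin.cons R.det α, ?_, ?_, ?_⟩
  · rw [det_mul, det_transpose, det_diagonal]
    exact (mul_ne_zero hR (Finset.prod_ne_zero_iff.mpr fun i _ => hα i)).isUnit
  · exact Fin.cases hR hα
  · refine Fin.cases ?_ fun i => ?_
    · have hdiag : diagonal α *ᵥ 1 = α := by
        ext1 i; simp [mulVec_diagonal]
      rw [standardFrame, Fin.cons_zero, Fin.cons_zero, ← mulVec_mulVec, hdiag, mulVec_cramer,
        det_transpose]
    · rw [standardFrame, Fin.cons_succ, Fin.cons_succ, ← mulVec_mulVec, diagonal_mulVec_single,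
        mul_one, mulVec_single, op_smul_eq_smul]
      rfl

end ProjectiveFrame

section PointIdeal

variable {k : Type*} [Field k]

lemma aeval_mul_algebraMap_of_isHomogeneous {R σ A : Type*} [CommSemiring R] [CommSemiring A]
    [Algebra R A] {d : ℕ} {g : MvPolynomial σ R} (hg : g.IsHomogeneous d) (s : A) (a : σ → R) :
    aeval (fun l => s * algebraMap R A (a l)) g = s ^ d * algebraMap R A (eval a g) := by
  rw [aeval_def, eval₂_eq, eval_eq, map_sum, Finset.mul_sum]
  refine Finset.sum_congr rfl fun e he => ?_
  simp only [mul_pow, Finset.prod_mul_distrib, map_mul, map_prod, map_pow]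
  rw [Finset.prod_pow_eq_pow_sum, ← hg.degree_eq_sum_deg_support he]
  ring

lemma eval_smul_of_isHomogeneous {R σ : Type*} [CommSemiring R] {d : ℕ} {g : MvPolynomial σ R}
    (hg : g.IsHomogeneous d) (c : R) (a : σ → R) : eval (c • a) g = c ^ d * eval a g :=
  aeval_mul_algebraMap_of_isHomogeneous hg c a

variable {n : ℕ} {p : ℙ k (Fin (n + 1) → k)} {f : MvPolynomial (Fin (n + 1)) k}

lemma mem_pointIdeal_of_eval_smul_eq_zero {c : k} (hc : c ≠ 0) {d : ℕ} (hf : f.IsHomogeneous d)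
    (h : eval (c • p.rep) f = 0) : f ∈ pointIdeal p := by
  rw [eval_smul_of_isHomogeneous hf] at h
  exact Ideal.subset_span ⟨d, hf, (mul_eq_zero.mp h).resolve_left (pow_ne_zero d hc)⟩

lemma aeval_eq_zero_of_mem_pointIdeal {A : Type*} [CommRing A] [Algebra k A] (hf : f ∈ pointIdeal p)
    (s : A) (c : k) : aeval (fun l => s * algebraMap k A ((c • p.rep) l)) f = 0 := by
  suffices pointIdeal p ≤ RingHom.ker (aeval fun l => s * algebraMap k A ((c • p.rep) l)) from
    this hf
  refine Ideal.span_le.mpr ?_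
  rintro g ⟨d, hg, hg0⟩
  refine (aeval_mul_algebraMap_of_isHomogeneous hg s (c • p.rep)).trans ?_
  rw [eval_smul_of_isHomogeneous hg, hg0, mul_zero, map_zero, mul_zero]

end PointIdeal

section ConicsNormalForm

variable {k A : Type*} [CommRing k] [CommRing A] [Algebra k A]

lemma map_comp_conics {B F : Type*} [CommRing B] [FunLike F A B] [RingHomClass F A B] (f : F)
    (x : Fin 3 → A) : f ∘ conics x = conics (f ∘ x) := by
  ext i
  fin_cases i <;> simp [conics]

lemma isHomogeneous_conics {σ : Type*} {y : Fin 3 → MvPolynomial σ k}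
    (hy : ∀ i, (y i).IsHomogeneous 1) (i : Fin 2) : (conics y i).IsHomogeneous 2 := by
  have h (a) : (y a * y a).IsHomogeneous 2 := (hy a).mul (hy a)
  fin_cases i
  exacts [(h 0).sub (h 2), (h 1).sub (h 2)]

/-- The normal form `a(z) + b(z) x + c(z) y + d(z) xy` of a polynomial in `x`, `y`, `z` modulo
`x² - z²` and `y² - z²`. -/
def conicsNormalForm (x : Fin 3 → A) (a b c d : Polynomial k) : A :=
  Polynomial.aeval (x 2) a + Polynomial.aeval (x 2) b * x 0 + Polynomial.aeval (x 2) c * x 1 +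
    Polynomial.aeval (x 2) d * (x 0 * x 1)

lemma map_conicsNormalForm {B : Type*} [CommRing B] [Algebra k B] (f : A →ₐ[k] B) (x : Fin 3 → A)
    (a b c d : Polynomial k) :
    f (conicsNormalForm x a b c d) = conicsNormalForm (f ∘ x) a b c d := by
  simp only [conicsNormalForm, map_add, map_mul, Polynomial.aeval_algHom_apply, Function.comp_apply]

lemma exists_aeval_sub_conicsNormalForm_mem (x : Fin 3 → A) (f : MvPolynomial (Fin 3) k) :
    ∃ a b c d : Polynomial k,
      aeval x f - conicsNormalForm x a b c d ∈ Ideal.span (Set.range (conics x)) := by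
  have hc (i) : conics x i ∈ Ideal.span (Set.range (conics x)) :=
    Ideal.subset_span (Set.mem_range_self i)
  induction f using MvPolynomial.induction_on with
  | C a => exact ⟨Polynomial.C a, 0, 0, 0, by simp [conicsNormalForm, algHom_C]⟩
  | add f g hf hg =>
    obtain ⟨a, b, c, d, hf⟩ := hf
    obtain ⟨a', b', c', d', hg⟩ := hg
    refine ⟨a + a', b + b', c + c', d + d', ?_⟩
    convert add_mem hf hg using 1
    simp only [conicsNormalForm, map_add]
    ring
  | mul_X f i hf =>
    obtain ⟨a, b, c, d, hf⟩ := hf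
    rw [map_mul, aeval_X]
    fin_cases i
    · refine ⟨b * Polynomial.X ^ 2, a, d * Polynomial.X ^ 2, c, ?_⟩
      convert add_mem (Ideal.mul_mem_left _ (x 0) hf) (Ideal.mul_mem_left _
        (Polynomial.aeval (x 2) b + Polynomial.aeval (x 2) d * x 1) (hc 0)) using 1
      simp only [conicsNormalForm, conics, map_mul, map_pow, Polynomial.aeval_X, Fin.isValue,
        Matrix.cons_val_zero, Fin.zero_eta]
      ring
    · refine ⟨c * Polynomial.X ^ 2, d * Polynomial.X ^ 2, a, b, ?_⟩
      convert add_mem (Ideal.mul_mem_left _ (x 1) hf) (Ideal.mul_mem_left _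
        (Polynomial.aeval (x 2) c + Polynomial.aeval (x 2) d * x 0) (hc 1)) using 1
      simp only [conicsNormalForm, conics, map_mul, map_pow, Polynomial.aeval_X, Fin.isValue,
        Matrix.cons_val_one, Matrix.cons_val_zero, Fin.mk_one]
      ring
    · refine ⟨a * Polynomial.X, b * Polynomial.X, c * Polynomial.X, d * Polynomial.X, ?_⟩
      convert Ideal.mul_mem_left _ (x 2) hf using 1
      simp only [conicsNormalForm, map_mul, Polynomial.aeval_X, Fin.isValue, Fin.reduceFinMk]
      ring

end ConicsNormalForm

section FourPoints

open Matrix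

variable {k : Type*} [Field k]

/-- The points `(±1, ±1, 1)`. -/
def signVec (k : Type*) [Field k] : Fin 4 → Fin 3 → k :=
  ![![1, 1, 1], ![-1, 1, 1], ![1, -1, 1], ![-1, -1, 1]]

lemma exists_mulVec_rep_eq_signVec (h2 : (2 : k) ≠ 0) {p : Fin 4 → ℙ k (Fin 3 → k)}
    (hp : InGeneralLinearPosition p) :
    ∃ m n : Matrix (Fin 3) (Fin 3) k, m * n = 1 ∧
      ∀ i, ∃ c : k, c ≠ 0 ∧ m *ᵥ (c • (p i).rep) = signVec k i := by
  obtain ⟨V, c, hV, hc, hVc⟩ := exists_mulVec_standardFrame_eq hp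
  let E : Matrix (Fin 3) (Fin 3) k := !![-1, 1, 1; 1, -1, 1; 1, 1, -1]
  let s : Fin 4 → k := ![1, 1, 1, -1]
  have hs (i) : s i ≠ 0 := by fin_cases i <;> simp [s]
  have hF : standardFrame k 2 = ![1, Pi.single 0 1, Pi.single 1 1, Pi.single 2 1] := by
    ext i
    fin_cases i <;> rfl
  have hEs (i) : s i • E *ᵥ standardFrame k 2 i = signVec k i := by
    rw [hF]
    ext j
    fin_cases i <;> fin_cases j <;>
      simp [s, E, signVec, dotProduct, Fin.sum_univ_three]
  have hE : IsUnit E.det := by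
    rw [isUnit_iff_ne_zero, show E.det = 2 * 2 by simp [E, det_fin_three]; norm_num]
    exact mul_ne_zero h2 h2
  have hEV : IsUnit (E * V⁻¹).det := by
    rw [det_mul]
    exact hE.mul (isUnit_nonsing_inv_det V hV)
  refine ⟨E * V⁻¹, (E * V⁻¹)⁻¹, mul_nonsing_inv _ hEV, fun i =>
    ⟨s i * c i, mul_ne_zero (hs i) (hc i), ?_⟩⟩
  rw [mul_smul, ← hVc, mulVec_smul, mulVec_mulVec, Matrix.mul_assoc, nonsing_inv_mul V hV,
    Matrix.mul_one, hEs]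

lemma conics_signVec (i : Fin 4) : conics (signVec k i) = 0 := by
  ext j
  fin_cases i <;> fin_cases j <;> simp [conics, signVec]

lemma span_conics_le_pointsIdeal {p : Fin 4 → ℙ k (Fin 3 → k)} {m : Matrix (Fin 3) (Fin 3) k}
    {c : Fin 4 → k} (hc : ∀ i, c i ≠ 0) (hm : ∀ i, m *ᵥ (c i • (p i).rep) = signVec k i) :
    Ideal.span (Set.range (conics m.toMvPolynomial)) ≤ pointsIdeal p := by
  refine le_iInf fun i => Ideal.span_le.mpr (Set.range_subset_iff.mpr fun j => ?_)
  refine mem_pointIdeal_of_eval_smul_eq_zero (hc i)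
    (isHomogeneous_conics m.toMvPolynomial_isHomogeneous j) ?_
  refine (congrFun (map_comp_conics (eval (c i • (p i).rep)) m.toMvPolynomial) j).trans ?_
  rw [eval_comp_toMvPolynomial, hm, conics_signVec, Pi.zero_apply]

lemma eq_zero_of_conicsNormalForm_signVec_eq_zero (h2 : (2 : k) ≠ 0) {a b c d : Polynomial k}
    (h : ∀ i, conicsNormalForm (fun r => Polynomial.X * Polynomial.C (signVec k i r)) a b c d = 0) :
    a = 0 ∧ b = 0 ∧ c = 0 ∧ d = 0 := by
  have z0 := h 0
  have z1 := h 1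
  have z2 := h 2
  have z3 := h 3
  simp only [conicsNormalForm, signVec, cons_val, map_one, map_neg, mul_one,
    Polynomial.aeval_X_left_apply] at z0 z1 z2 z3
  have h4 : (4 : Polynomial k) ≠ 0 := by
    have : (4 : Polynomial k) = Polynomial.C (2 * 2) := by rw [map_mul, map_ofNat]; norm_num
    rw [this, Polynomial.C_ne_zero]
    exact mul_ne_zero h2 h2
  have hX := Polynomial.X_ne_zero (R := k)
  refine ⟨mul_left_cancel₀ h4 ?_, mul_left_cancel₀ (mul_ne_zero h4 hX) ?_,
    mul_left_cancel₀ (mul_ne_zero h4 hX) ?_,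
    mul_left_cancel₀ (mul_ne_zero h4 (mul_ne_zero hX hX)) ?_⟩
  · linear_combination z0 + z1 + z2 + z3
  · linear_combination z0 - z1 + z2 - z3
  · linear_combination z0 + z1 - z2 - z3
  · linear_combination z0 - z1 - z2 + z3

lemma pointsIdeal_eq_span_conics (h2 : (2 : k) ≠ 0) {p : Fin 4 → ℙ k (Fin 3 → k)}
    {m n : Matrix (Fin 3) (Fin 3) k} (h : m * n = 1)
    (hm : ∀ i, ∃ c : k, c ≠ 0 ∧ m *ᵥ (c • (p i).rep) = signVec k i) :
    pointsIdeal p = Ideal.span (Set.range (conics m.toMvPolynomial)) := by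
  choose γ hγ0 hγ using hm
  have hle := span_conics_le_pointsIdeal hγ0 hγ
  refine le_antisymm (fun f hf => ?_) hle
  obtain ⟨f, rfl⟩ :=
    (aeval_toMvPolynomial_leftInverse (mul_eq_one_comm.mp h)).surjective f
  obtain ⟨a, b, c, d, hnf⟩ := exists_aeval_sub_conicsNormalForm_mem m.toMvPolynomial f
  have hzero (i) :
      conicsNormalForm (fun r => Polynomial.X * Polynomial.C (signVec k i r)) a b c d = 0 := by
    -- Restriction to the line through the point, parametrized by its vector `γ i • (p i).rep`.
    let ρ : MvPolynomial (Fin 3) k →ₐ[k] Polynomial k :=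
      aeval fun l => Polynomial.X * algebraMap k _ ((γ i • (p i).rep) l)
    have hρ : ρ ∘ m.toMvPolynomial = fun r => Polynomial.X * Polynomial.C (signVec k i r) := by
      ext1 r
      refine (aeval_mul_algebraMap_of_isHomogeneous (m.toMvPolynomial_isHomogeneous r) _ _).trans ?_
      rw [pow_one, toMvPolynomial_eval_eq_apply, hγ, Polynomial.algebraMap_eq]
    have hker {g} (hg : g ∈ pointsIdeal p) : ρ g = 0 :=
      aeval_eq_zero_of_mem_pointIdeal (Ideal.mem_iInf.mp hg i) _ _
    rw [← hρ, ← map_conicsNormalForm, ← hker hf, eq_comm, ← sub_eq_zero, ← map_sub]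
    exact hker (hle hnf)
  obtain ⟨rfl, rfl, rfl, rfl⟩ := eq_zero_of_conicsNormalForm_signVec_eq_zero h2 hzero
  simpa [conicsNormalForm] using hnf

end FourPoints

section SquareMultiples

open Matrix

variable {A : Type*} [CommRing A] (x : Fin 3 → A)

lemma varMulSq_mulVec_quadrics :
    varMulSq x *ᵥ quadrics x = fun i => x i * (x 2 * x 2) := by
  rw [varMulSq_mulVec]
  ext i
  fin_cases i <;> simp [quadrics] <;> ring

lemma quadricsMulSq_mulVec_quadrics :
    quadricsMulSq (quadrics x) *ᵥ quadrics x = fun j => quadrics x j * (x 2 * x 2) := by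
  rw [quadricsMulSq_mulVec]
  ext j
  fin_cases j <;> simp [quadrics] <;> ring

lemma quadrics_mem_span (i : Fin 5) : quadrics x i ∈ Ideal.span (Set.range (quadrics x)) :=
  Ideal.subset_span (Set.mem_range_self i)

lemma var_mul_sq_mem_span_quadrics (i : Fin 3) :
    x i * (x 2 * x 2) ∈ Ideal.span (Set.range (quadrics x)) := by
  rw [← congrFun (varMulSq_mulVec_quadrics x) i, mulVec, dotProduct]
  exact Ideal.sum_mem _ fun j _ => Ideal.mul_mem_left _ _ (quadrics_mem_span x j)

lemma quadricsMulSq_quadrics_mem (i j : Fin 5) :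
    quadricsMulSq (quadrics x) i j ∈ Ideal.span (Set.range (quadrics x)) := by
  have hq := quadrics_mem_span x
  fin_cases i <;> fin_cases j <;> simp [quadricsMulSq, hq]

lemma mul_sq_mem_span_quadrics_sq {f : A} (hf : f ∈ Ideal.span (Set.range (quadrics x))) :
    f * (x 2 * x 2) ∈ Ideal.span (Set.range (quadrics x)) ^ 2 := by
  obtain ⟨c, rfl⟩ := Ideal.mem_span_range_iff_exists_fun.mp hf
  rw [Finset.sum_mul]
  refine Ideal.sum_mem _ fun i _ => ?_
  rw [mul_assoc, ← congrFun (quadricsMulSq_mulVec_quadrics x) i, mulVec,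
    dotProduct, sq]
  exact Ideal.mul_mem_left _ _ (Ideal.sum_mem _ fun j _ =>
    Ideal.mul_mem_mul (quadricsMulSq_quadrics_mem x i j) (quadrics_mem_span x j))

variable {k : Type*} [Field k] {m n : Matrix (Fin 3) (Fin 3) k}

lemma X_mul_sq_mem_span_quadrics (h : m * n = 1) (l : Fin 3) :
    X l * (m.toMvPolynomial 2 * m.toMvPolynomial 2) ∈
      Ideal.span (Set.range (quadrics m.toMvPolynomial)) := by
  rw [← congrFun (map_mulVec_toMvPolynomial h) l, mulVec, dotProduct, Finset.sum_mul]
  refine Ideal.sum_mem _ fun i _ => ?_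
  rw [mul_assoc]
  exact Ideal.mul_mem_left _ _ (var_mul_sq_mem_span_quadrics _ i)

lemma sq_notMem_span_quadrics (h : m * n = 1) :
    m.toMvPolynomial 2 * m.toMvPolynomial 2 ∉
      Ideal.span (Set.range (quadrics m.toMvPolynomial)) := by
  have hy := m.toMvPolynomial_isHomogeneous
  intro hmem
  obtain ⟨P, hP⟩ := exists_map_mulVec_eq_of_span_le (κ := Unit) (fun _ => (hy 2).mul (hy 2))
    (isHomogeneous_quadrics hy) (Ideal.span_le.mpr (Set.range_subset_iff.mpr fun _ => hmem))
  refine neg_ne_zero.mpr one_ne_zero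
    (eq_zero_of_dotProduct_quadrics_add_eq_zero (c := P ()) (c' := -1) fun x => ?_).2
  have hx := (congrArg (eval (n *ᵥ x)) (congrFun hP ())).trans (eval_dotProduct_quadrics h x (P ()))
  rw [← hx, map_mul, toMvPolynomial_eval_eq_apply, mulVec_mulVec, h, one_mulVec]
  ring

end SquareMultiples

end JacobianRees

end

theorem proposition3p1_general {k : Type*} [Field k] (h2 : (2 : k) ≠ 0)
    (p : Fin 4 → ℙ k (Fin 3 → k)) (hp : InGeneralLinearPosition p)
    {m : ℕ} (g : Fin m → MvPolynomial (Fin 3) k)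
    (hg : Ideal.span (Set.range g) = pointsIdeal p)
    (I : Ideal (MvPolynomial (Fin 3) k)) (hI : I = jacobianIdeal 2 g) :
    (∃ φ : Matrix (Fin 5) (Fin 5) (MvPolynomial (Fin 3) k), IsPfaffianMatrix φ I) ∧
    (∀ φ : Matrix (Fin 5) (Fin 5) (MvPolynomial (Fin 3) k), IsPfaffianMatrix φ I →
      (∃ e : (MvPolynomial (Fin 5) (MvPolynomial (Fin 3) k) ⧸ dualIdeal φ)
            ≃ₐ[MvPolynomial (Fin 3) k] reesAlgebra I,
          ∀ i, (e (Ideal.Quotient.mk (dualIdeal φ) (MvPolynomial.X i)) :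
              Polynomial (MvPolynomial (Fin 3) k)) =
            Polynomial.monomial 1 (pfaffians φ i)) ∧
      HasFiberTypeRelations (pfaffians φ)) ∧
    IsFiberType I ∧
    depthAlong (reesMaximalIdeal I) = 1 := by
  obtain ⟨a, b, hab, hpt⟩ := exists_mulVec_rep_eq_signVec h2 hp
  obtain rfl : I = Ideal.span (Set.range (quadrics a.toMvPolynomial)) := by
    rw [hI, jacobianIdeal_congr 2 (hg.trans (pointsIdeal_eq_span_conics h2 hab hpt)),
      jacobianIdeal_conics h2 hab]
  have hφ₀ := isPfaffianMatrix_quadricsMatrix a.toMvPolynomial_isHomogeneous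
  have hrees {φ} (hφ : IsPfaffianMatrix φ _) : dualIdeal φ = reesIdeal (pfaffians φ) :=
    dualIdeal_eq_reesIdeal h2 hab hφ
  have hfiber {φ} (hφ : IsPfaffianMatrix φ _) : HasFiberTypeRelations (pfaffians φ) :=
    hasFiberTypeRelations_of_dualIdeal_eq hφ.linear (hrees hφ)
  refine ⟨⟨_, hφ₀⟩, fun φ hφ => ⟨exists_equiv_reesAlgebra hφ.span_eq (hrees hφ), hfiber hφ⟩,
    ⟨5, 2, _, isHomogeneous_pfaffians hφ₀.linear, hφ₀.span_eq, hfiber hφ₀⟩, ?_⟩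
  exact depthAlong_reesMaximalIdeal_eq_one (sq_notMem_span_quadrics hab)
    (X_mul_sq_mem_span_quadrics hab) fun f hf => mul_sq_mem_span_quadrics_sq _ hf

theorem proposition3p1 {k : Type*} [Field k] [IsAlgClosed k] (h2 : (2 : k) ≠ 0)
    (p : Fin 4 → ℙ k (Fin 3 → k)) (hp : InGeneralLinearPosition p)
    {m : ℕ} (g : Fin m → MvPolynomial (Fin 3) k)
    (hg : Ideal.span (Set.range g) = pointsIdeal p)
    (I : Ideal (MvPolynomial (Fin 3) k)) (hI : I = jacobianIdeal 2 g) :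
    (∃ φ : Matrix (Fin 5) (Fin 5) (MvPolynomial (Fin 3) k), IsPfaffianMatrix φ I) ∧
    (∀ φ : Matrix (Fin 5) (Fin 5) (MvPolynomial (Fin 3) k), IsPfaffianMatrix φ I →
      (∃ e : (MvPolynomial (Fin 5) (MvPolynomial (Fin 3) k) ⧸ dualIdeal φ)
            ≃ₐ[MvPolynomial (Fin 3) k] reesAlgebra I,
          ∀ i, (e (Ideal.Quotient.mk (dualIdeal φ) (MvPolynomial.X i)) :
              Polynomial (MvPolynomial (Fin 3) k)) =
            Polynomial.monomial 1 (pfaffians φ i)) ∧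
      HasFiberTypeRelations (pfaffians φ)) ∧
    IsFiberType I ∧
    depthAlong (reesMaximalIdeal I) = 1 := by
  exact proposition3p1_general h2 p hp g hg I hI
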